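/- Let $M$ be an oriented smooth manifold (Hausdorff, second countable) of dimension $n\ge 2$. A sub-Riemannian structure on $M$ consists of a smooth Euclidean vector bundle $(\mathbf U,\langle\cdot,\cdot\rangle)$ over $M$ and a morphism of vector bundles $f:\mathbf U\to TM$. Let $\mathcal D=\{f\circ\sigma : \sigma \text{ a smooth section of }\mathbf U\}$, $\mathcal D_q=f(\mathbf U_q)$, and $g_q(v)=\inf\{\langle u,u\rangle_q : u\in\mathbf U_q,\ f(u)=v\}$. Assume that $\mathcal D$ is Lie bracket generating, i.e. the Lie algebra generated by $\mathcal D$ spans $T_qM$ at every $q\in M$. Put $\mathcal D^0=0$, $\mathcal D^1=\mathcal D$, $\mathcal D^{i+1}=\mathcal D^i+[\mathcal D,\mathcal D^i]$, $\mathcal D^i_q=\{X(q):X\in\mathcal D^i\}$, $n_i(q)=\dim\mathcal D^i_q$. Let $r(q)$ be the first integer with $\mathcal D^{r(q)}_q=T_qM$, and let $Q(q)=\sum_{i=1}^{r(q)} i\,(n_i(q)-n_{i-1}(q))$. The set $\mathsf R$ of regular points consists of the points near which all the $n_i$ are constant. Let $X_1,\dots,X_m$ be a generating family: smooth vector fields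 that generate $\mathcal D$ as a $C^\infty(M)$-module and satisfy $g_q(v)=\inf\{\sum_a u_a^2 : v=\sum_a u_aX_a(q)\}$ for all $q\in M$, $v\in T_qM$. An $n$-tuple $(Y_1,\dots,Y_n)$ of iterated brackets $[X_{i_1},[X_{i_2},\dots,[X_{i_{j-1}},X_{i_j}]\dots]]$ is called a frame of brackets adapted at $q$ if $(Y_1(q),\dots,Y_n(q))$ is a basis of $T_qM$ and the lengths of the brackets add up to $Q(q)$. Let $\omega$ be a smooth non-degenerate $n$-form on $M$, let $\mu$ be the associated smooth volume, and let $$\nu(q)=\max\{\omega_q(Y_1(q),\dots,Y_n(q)) : (Y_1,\dots,Y_n)\text{ a frame of brackets adapted at }q\}.$$ Popp's measure $\mathscr P^{\mathsf R}$ is defined as follows. Let $p\in\mathsf R$. The scalar product of $\mathcal D_p$ whose squared norm is $g_p$ induces one on $\otimes^i\mathcal D_p$. The surjective map $\pi_i:\otimes^i\mathcal D_p\to\mathcal D^i_p/\mathcal D^{i-1}_p$, $$\pi_i(v_1\otimes\dots\otimes v_i)=[V_1,[V_2,\dots,[V_{i-1},V_i]\dots]](p) \bmod \mathcal D^{i-1}_p\qquad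 (V_j\in\mathcal D,\ V_j(p)=v_j),$$ is well defined and gives $\mathcal D^i_p/\mathcal D^{i-1}_p$ the scalar product with norm $|w|=\min\{|e| : \pi_i(e)=w\}$; so $\mathfrak{gr}_p(\mathcal D)=\bigoplus_{i=1}^{r(p)}\mathcal D^i_p/\mathcal D^{i-1}_p$ is a Euclidean space. Let $\mathscr V_p\in\Lambda^n\mathfrak{gr}_p(\mathcal D)^*$ be the wedge product of the elements of the dual of an orthonormal basis (defined up to sign) and let $\varpi_p=\theta_p^{-1}(\mathscr V_p)\in\Lambda^nT_p^*M$, where $\theta_p:\Lambda^nT^*_pM\to\Lambda^n\mathfrak{gr}_p(\mathcal D)^*$ is the canonical isomorphism. Then $\mathscr P^{\mathsf R}$ is the measure associated with the volume form $\varpi$ (that is, with $|\varpi|$) on $\mathsf R$, extended by $0$ to $M\setminus\mathsf R$. Proposition. The measure $\mathscr P^{\mathsf R}$ has a continuous density $\frac{d\mathscr P^{\mathsf R}}{d\mu}$ on $\mathsf R$ with respect to $\mu$, and for every compact subset $K\subset M$ there is a constant $C>0$ such that, for every $q\in\mathsf R\cap K$, the maximum $\nu(q)$ exists and is positive, and $$\frac{1}{C\,\nu(q)}\le\frac{d\mathscr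 P^{\mathsf R}}{d\mu}(q)\le\frac{C}{\nu(q)} .$$ -/

import Mathlib

open Bundle Manifold MeasureTheory
open scoped ContDiff Topology ENNReal TensorProduct

noncomputable section

namespace Popp

/-! ### Inner product induced by a linear map -/

section Induced

variable {E V : Type*} [NormedAddCommGroup E] [InnerProductSpace ℝ E] [FiniteDimensional ℝ E]
  [AddCommGroup V] [Module ℝ V]

/-- The infimum of the squared norms of the preimages of `v` under `f`. -/
def sqNormInf (f : E →ₗ[ℝ] V) (v : V) : ℝ :=
  sInf {t | ∃ u : E, f u = v ∧ t = inner ℝ u u}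

/-- The linear section of `f : E → range f` with values in the orthogonal complement of the
kernel of `f`. -/
def orthSection (f : E →ₗ[ℝ] V) : LinearMap.range f →ₗ[ℝ] E :=
  (LinearMap.ker f)ᗮ.subtype ∘ₗ
    (f.kerComplementEquivRange (Submodule.isCompl_orthogonal _).symm).symm.toLinearMap

/-- The inner product induced on `range f` by the surjection `f : E → range f`. -/
def inducedForm (f : E →ₗ[ℝ] V) : LinearMap.BilinForm ℝ (LinearMap.range f) :=
  (innerₗ E).compl₁₂ (orthSection f) (orthSection f)

theorem apply_orthSection (f : E →ₗ[ℝ] V) (v : LinearMap.range f) :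
    f (orthSection f v) = v := by
  have h := (f.kerComplementEquivRange
    (Submodule.isCompl_orthogonal (LinearMap.ker f)).symm).apply_symm_apply v
  exact congrArg Subtype.val h

/-- The norm associated with the induced inner product is the minimum of the norms of the
preimages. -/
theorem inducedForm_isLeast (f : E →ₗ[ℝ] V) (v : LinearMap.range f) :
    IsLeast {t | ∃ u : E, f u = v ∧ t = inner ℝ u u} (inducedForm f v v) := by
  refine ⟨⟨orthSection f v, apply_orthSection f v, rfl⟩, ?_⟩
  rintro t ⟨u, hu, rfl⟩
  have hs : orthSection f v ∈ (LinearMap.ker f)ᗮ := by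
    simp [orthSection]
  have hk : u - orthSection f v ∈ LinearMap.ker f := by
    rw [LinearMap.mem_ker, map_sub, hu, apply_orthSection, sub_self]
  have h0 : inner ℝ (u - orthSection f v) (orthSection f v) = 0 :=
    (Submodule.mem_orthogonal _ _).1 hs _ hk
  have h1 : inner ℝ u u = inner ℝ (orthSection f v) (orthSection f v)
      + inner ℝ (u - orthSection f v) (u - orthSection f v) := by
    have h0' : inner ℝ (orthSection f v) (u - orthSection f v) = 0 := by
      rw [real_inner_comm]; exact h0
    conv_lhs => rw [← sub_add_cancel u (orthSection f v)]
    rw [inner_add_left, inner_add_right, inner_add_right, h0, h0']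
    ring
  have h2 : 0 ≤ inner ℝ (u - orthSection f v) (u - orthSection f v) := real_inner_self_nonneg
  change inner ℝ (orthSection f v) (orthSection f v) ≤ inner ℝ u u
  linarith

theorem inducedForm_self (f : E →ₗ[ℝ] V) (v : LinearMap.range f) :
    inducedForm f v v = sqNormInf f v :=
  (inducedForm_isLeast f v).csInf_eq.symm

/-- The bilinear form on the `i`-th tensor power of `W` with
`⟨v₁ ⊗ ⋯ ⊗ vᵢ, w₁ ⊗ ⋯ ⊗ wᵢ⟩ = ∏ⱼ B vⱼ wⱼ`. -/
def tensorForm {W : Type*} [AddCommGroup W] [Module ℝ W] (B : LinearMap.BilinForm ℝ W) (i : ℕ) :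
    LinearMap.BilinForm ℝ (⨂[ℝ] _j : Fin i, W) :=
  PiTensorProduct.dualDistrib ∘ₗ PiTensorProduct.map (fun _ => B)

theorem tensorForm_tprod {W : Type*} [AddCommGroup W] [Module ℝ W]
    (B : LinearMap.BilinForm ℝ W) (i : ℕ) (v w : Fin i → W) :
    tensorForm B i (PiTensorProduct.tprod ℝ v) (PiTensorProduct.tprod ℝ w) =
      ∏ j, B (v j) (w j) := by
  simp [tensorForm, PiTensorProduct.map_tprod]

end Induced

/-! ### Vector fields, volume forms and the associated measures -/

section Manifold

variable {n : ℕ} {M : Type*} [TopologicalSpace M] [ChartedSpace (EuclideanSpace ℝ (Fin n)) M]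

variable (n M) in
/-- Vector fields on `M`, without any regularity. -/
abbrev VField : Type _ := (x : M) → TangentSpace (𝓡 n) x

/-- Smooth vector fields. -/
def VField.Smooth [IsManifold (𝓡 n) ∞ M] (V : VField n M) : Prop :=
  ContMDiff (𝓡 n) (𝓡 n).tangent ∞ (fun x => (⟨x, V x⟩ : TangentBundle (𝓡 n) M))

variable (n M) in
/-- Differential forms of top degree on `M`, without any regularity. -/
abbrev TopForm : Type _ := (x : M) → (TangentSpace (𝓡 n) x) [⋀^Fin n]→ₗ[ℝ] ℝ

/-- The value of the form `Ω` on the coordinate frame of the chart `e`, as a function of the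
coordinates. -/
def coordCoeff (e : OpenPartialHomeomorph M (EuclideanSpace ℝ (Fin n))) (Ω : TopForm n M)
    (y : EuclideanSpace ℝ (Fin n)) : ℝ :=
  Ω (e.symm y) (fun k => mfderiv (𝓡 n) (𝓡 n) e.symm y (EuclideanSpace.single k (1 : ℝ)))

/-- `Ω` is a smooth non-degenerate form of top degree. -/
structure IsVolumeForm (Ω : TopForm n M) : Prop where
  smooth : ∀ e ∈ atlas (EuclideanSpace ℝ (Fin n)) M, ContDiffOn ℝ ∞ (coordCoeff e Ω) e.target
  ne_zero : ∀ x, Ω x ≠ 0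

/-- The measure on `M`, concentrated on the domain of the chart `e`, that is given in this chart
by the density `|Ω(∂₁, …, ∂ₙ)|` with respect to the Lebesgue measure. -/
def chartMeasure [MeasurableSpace M] (e : OpenPartialHomeomorph M (EuclideanSpace ℝ (Fin n)))
    (Ω : TopForm n M) : Measure M :=
  Measure.map e.symm
    ((volume.restrict e.target).withDensity (fun y => ENNReal.ofReal |coordCoeff e Ω y|))

/-- The measure `∫ |Ω|` associated with a form `Ω` of top degree. By the change of variables
formula the measures `chartMeasure e Ω` agree on the overlaps of the charts, so their supremum is
the measure that coincides with `chartMeasure e Ω` on the domain of each chart `e`. -/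
def formMeasure [MeasurableSpace M] (Ω : TopForm n M) : Measure M :=
  ⨆ x : M, chartMeasure (chartAt (EuclideanSpace ℝ (Fin n)) x) Ω

/-- The right-normed iterated bracket `[V₁, [V₂, …, [Vⱼ₋₁, Vⱼ]…]]`. -/
def iteratedBracket : List (VField n M) → VField n M
  | [] => 0
  | [V] => V
  | V :: W :: l => VectorField.mlieBracket (𝓡 n) V (iteratedBracket (W :: l))

end Manifold

/-! ### Sub-Riemannian structures -/

section SubRiemannian

variable {n : ℕ} {M : Type*} [TopologicalSpace M] [ChartedSpace (EuclideanSpace ℝ (Fin n)) M]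
  [IsManifold (𝓡 n) ∞ M]
  {F : Type*} [NormedAddCommGroup F] [NormedSpace ℝ F]
  {U : M → Type*} [TopologicalSpace (TotalSpace F U)]
  [∀ x, NormedAddCommGroup (U x)] [∀ x, InnerProductSpace ℝ (U x)]
  [FiberBundle F U] [VectorBundle ℝ F U] [ContMDiffVectorBundle ∞ F U (𝓡 n)]

variable (n F U) in
/-- A morphism of vector bundles `f : U → TM`, that is, a map which is smooth and linear on the
fibres. Together with a smoothly varying scalar product on `U` it is a sub-Riemannian structure
on `M`. -/
structure SubRiemannianStructure where
  /-- the morphism on the fibres -/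
  f : (x : M) → U x →ₗ[ℝ] TangentSpace (𝓡 n) x
  smooth : ContMDiff ((𝓡 n).prod 𝓘(ℝ, F)) (𝓡 n).tangent ∞
    (fun u : TotalSpace F U => (⟨u.1, f u.1 u.2⟩ : TangentBundle (𝓡 n) M))

namespace SubRiemannianStructure

variable (S : SubRiemannianStructure n F U)

/-- The module `𝒟 = {f ∘ σ | σ smooth section of U}`. -/
def horizontal : Submodule ℝ (VField n M) :=
  LinearMap.range
    ({ toFun := fun σ x => S.f x (σ x)
       map_add' := fun σ τ => by ext1 x; simp
       map_smul' := fun c σ => by ext1 x; simp } :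
      ContMDiffSection (𝓡 n) F ∞ U →ₗ[ℝ] VField n M)

/-- `𝒟⁰ = 0`, `𝒟¹ = 𝒟`, `𝒟ⁱ⁺¹ = 𝒟ⁱ + [𝒟, 𝒟ⁱ]`. -/
def flag : ℕ → Submodule ℝ (VField n M)
  | 0 => ⊥
  | 1 => S.horizontal
  | i + 2 => flag (i + 1) ⊔ Submodule.span ℝ
      {Z | ∃ X ∈ S.horizontal, ∃ Y ∈ flag (i + 1), Z = VectorField.mlieBracket (𝓡 n) X Y}

/-- `𝒟ⁱ_p = {X(p) | X ∈ 𝒟ⁱ}`. -/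
def flagAt (i : ℕ) (p : M) : Submodule ℝ (TangentSpace (𝓡 n) p) :=
  (S.flag i).map (LinearMap.proj p)

/-- The Lie algebra generated by `𝒟`. -/
def lieHull : Submodule ℝ (VField n M) :=
  sInf {L | S.horizontal ≤ L ∧ ∀ X ∈ L, ∀ Y ∈ L, VectorField.mlieBracket (𝓡 n) X Y ∈ L}

/-- The Lie bracket generating condition: `Lie_q 𝒟 = T_q M` for every `q`. -/
def BracketGenerating : Prop :=
  ∀ q : M, S.lieHull.map (LinearMap.proj q) = ⊤

/-- `n_i(p) = dim 𝒟ⁱ_p`. -/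
def growth (i : ℕ) (p : M) : ℕ := Module.finrank ℝ (S.flagAt i p)

/-- `r(p)`, the first integer such that `𝒟^{r(p)}_p = T_p M`. -/
def step (p : M) : ℕ := sInf {r | S.flagAt r p = ⊤}

/-- `Q(p) = ∑_{i = 1}^{r(p)} i (n_i(p) - n_{i-1}(p))`. -/
def homDim (p : M) : ℤ :=
  ∑ i ∈ Finset.range (S.step p), ((i : ℤ) + 1) * ((S.growth (i + 1) p : ℤ) - S.growth i p)

/-- The set of regular points: every `n_i` is constant near `p`. -/
def regularSet : Set M := {p | ∀ᶠ q in 𝓝 p, ∀ i, S.growth i q = S.growth i p}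

/-- The squared length `g_q(v)` of a vector `v` of `𝒟_q`. -/
def metric (q : M) (v : TangentSpace (𝓡 n) q) : ℝ := sqNormInf (S.f q) v

/-! ### Generating families and adapted frames of brackets -/

/-- `X₁, …, X_m` is a (global) generating family: these are smooth vector fields, `𝒟` is the
`C^∞(M)`-module that they generate, and `g_q(v) = inf {∑ uᵢ² | v = ∑ uᵢ Xᵢ(q)}`. (For
`v ∉ 𝒟_q` both infima are infima of the empty set, and the equality is void.) -/
structure IsGeneratingFamily {m : ℕ} (X : Fin m → VField n M) : Prop where
  smooth : ∀ a, (X a).Smooth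
  mem_iff : ∀ V : VField n M, V ∈ S.horizontal ↔
    ∃ c : Fin m → M → ℝ, (∀ a, ContMDiff (𝓡 n) 𝓘(ℝ, ℝ) ∞ (c a)) ∧
      ∀ x, V x = ∑ a, c a x • X a x
  metric_eq : ∀ (q : M) (v : TangentSpace (𝓡 n) q),
    S.metric q v = sInf {t | ∃ u : Fin m → ℝ, v = ∑ a, u a • X a q ∧ t = ∑ a, u a ^ 2}

/-- The words `I k = (i₁, …, i_j)` are such that the brackets
`Y_k = [X_{i₁}, [X_{i₂}, …, [X_{i_{j-1}}, X_{i_j}]…]]` are a frame of brackets adapted at `p`: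
they form a basis at `p` and the sum of their lengths is `Q(p)`. -/
structure IsAdaptedFrame {m : ℕ} (X : Fin m → VField n M) (p : M)
    (I : Fin n → List (Fin m)) : Prop where
  nonempty : ∀ k, I k ≠ []
  linearIndependent : LinearIndependent ℝ (fun k => iteratedBracket ((I k).map X) p)
  span_eq_top : Submodule.span ℝ (Set.range fun k => iteratedBracket ((I k).map X) p) = ⊤
  length_eq : ((∑ k, (I k).length : ℕ) : ℤ) = S.homDim p

/-- The values of `Ω_q(Y₁, …, Yₙ)` over the frames of brackets adapted at `q`. -/
def frameValues {m : ℕ} (X : Fin m → VField n M) (Ω : TopForm n M) (q : M) : Set ℝ :=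
  {t | ∃ I : Fin n → List (Fin m), S.IsAdaptedFrame X q I ∧
    t = Ω q (fun k => iteratedBracket ((I k).map X) q)}

/-- `ν(q)`, the maximum of `Ω_q(Y₁, …, Yₙ)` over the frames of brackets adapted at `q`. -/
def nu {m : ℕ} (X : Fin m → VField n M) (Ω : TopForm n M) (q : M) : ℝ :=
  sSup (S.frameValues X Ω q)

/-! ### Popp's measure -/

/-- The fibre `𝒟_p = f(U_p)`. -/
abbrev fiber (p : M) : Submodule ℝ (TangentSpace (𝓡 n) p) := LinearMap.range (S.f p)

/-- The maps `φ : ⊗ⁱ⁺¹ 𝒟_p → 𝒟ⁱ⁺¹_p / 𝒟ⁱ_p ⊆ T_pM / 𝒟ⁱ_p` with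
`φ(v₁ ⊗ ⋯ ⊗ vᵢ₊₁) = [V₁, [V₂, …, [Vᵢ, Vᵢ₊₁]…]](p) mod 𝒟ⁱ_p` for all sections `V_j ∈ 𝒟` such that
`V_j(p) = v_j`. -/
def IsBracketMap (p : M) (i : ℕ)
    (φ : (⨂[ℝ] _j : Fin (i + 1), S.fiber p) →ₗ[ℝ] (TangentSpace (𝓡 n) p ⧸ S.flagAt i p)) : Prop :=
  ∀ (v : Fin (i + 1) → S.fiber p) (V : Fin (i + 1) → VField n M),
    (∀ j, V j ∈ S.horizontal) → (∀ j, V j p = v j) →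
      φ (PiTensorProduct.tprod ℝ v) = (S.flagAt i p).mkQ (iteratedBracket (List.ofFn V) p)

open Classical in
/-- The map `πᵢ₊₁ : ⊗ⁱ⁺¹ 𝒟_p → T_pM / 𝒟ⁱ_p` induced by the brackets. It is well defined at the
regular points (where it exists and is unique); the value is `0` where it is not. -/
def bracketMap (p : M) (i : ℕ) :
    (⨂[ℝ] _j : Fin (i + 1), S.fiber p) →ₗ[ℝ] (TangentSpace (𝓡 n) p ⧸ S.flagAt i p) :=
  if h : ∃ φ, S.IsBracketMap p i φ then h.choose else 0

/-- The space `𝒟ⁱ⁺¹_p / 𝒟ⁱ_p`, as a subspace of `T_pM / 𝒟ⁱ_p`. -/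
abbrev grPiece (p : M) (i : ℕ) : Submodule ℝ (TangentSpace (𝓡 n) p ⧸ S.flagAt i p) :=
  (S.flagAt (i + 1) p).map (S.flagAt i p).mkQ

/-- The graded space `gr_p(𝒟) = 𝒟¹_p ⊕ 𝒟²_p / 𝒟¹_p ⊕ ⋯ ⊕ 𝒟ʳ_p / 𝒟ʳ⁻¹_p` with `r = r(p)`. -/
abbrev Gr (p : M) : Type _ := (i : Fin (S.step p)) → S.grPiece p i

section

variable [FiniteDimensional ℝ F]

/-- The inner product of `𝒟_p` whose squared norm is `g_p`. -/
def metricForm (p : M) : LinearMap.BilinForm ℝ (S.fiber p) :=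
  haveI : FiniteDimensional ℝ (U p) := VectorBundle.finiteDimensional ℝ F U p
  inducedForm (S.f p)

theorem metricForm_self (p : M) (v : S.fiber p) : S.metricForm p v v = S.metric p v := by
  have : FiniteDimensional ℝ (U p) := VectorBundle.finiteDimensional ℝ F U p
  exact inducedForm_self (S.f p) v

/-- The squared norm that `πᵢ₊₁` induces on `𝒟ⁱ⁺¹_p / 𝒟ⁱ_p`:
`|w|² = min {|e|² | e ∈ ⊗ⁱ⁺¹ 𝒟_p, πᵢ₊₁(e) = w}`. -/
def pieceSqNorm (p : M) (i : ℕ) (w : S.grPiece p i) : ℝ :=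
  sInf {t | ∃ e : ⨂[ℝ] _j : Fin (i + 1), S.fiber p,
    S.bracketMap p i e = w ∧ t = tensorForm (S.metricForm p) (i + 1) e e}

/-- The squared norm of the graded space, as orthogonal sum of its pieces. -/
def grSqNorm (p : M) (w : S.Gr p) : ℝ := ∑ i : Fin (S.step p), S.pieceSqNorm p i (w i)

/-- `b` is an orthonormal basis of the graded space, that is, the squared norm is the sum of the
squares of the coordinates in `b`. -/
def IsOrthonormalBasis (p : M) (b : Module.Basis (Fin n) ℝ (S.Gr p)) : Prop :=
  ∀ c : Fin n → ℝ, S.grSqNorm p (∑ k, c k • b k) = ∑ k, c k ^ 2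

/-- `L : gr_p(𝒟) → T_pM` maps the class of a vector of `𝒟ⁱ⁺¹_p` modulo `𝒟ⁱ_p` to an element
of this class. -/
def IsSplitting (p : M) (L : S.Gr p ≃ₗ[ℝ] TangentSpace (𝓡 n) p) : Prop :=
  ∀ (i : Fin (S.step p)) (w : S.grPiece p i),
    (S.flagAt i p).mkQ (L (Pi.single i w)) = w

/-- `ϖ = ± θ_p⁻¹(𝒱_p)`: here `𝒱_p` is the wedge product of the basis dual to an orthonormal
basis `b` of the graded space, and the canonical isomorphism `θ_p` of `Λⁿ T_p^*M` with
`Λⁿ gr_p(𝒟)^*` is the pull-back by any splitting. -/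
def IsPoppFormAt (p : M) (ϖ : (TangentSpace (𝓡 n) p) [⋀^Fin n]→ₗ[ℝ] ℝ) : Prop :=
  ∃ b : Module.Basis (Fin n) ℝ (S.Gr p), S.IsOrthonormalBasis p b ∧
    ∃ L : S.Gr p ≃ₗ[ℝ] TangentSpace (𝓡 n) p, S.IsSplitting p L ∧
      ϖ.compLinearMap L.toLinearMap = b.det

open Classical in
/-- The form `ϖ` at the regular points, which is determined up to a sign at each point, and `0`
at the singular points. -/
def poppForm : TopForm n M := fun p =>
  if h : p ∈ S.regularSet ∧ ∃ ϖ, S.IsPoppFormAt p ϖ then h.2.choose else 0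

/-- Popp's measure: the measure on `M` that is associated with the volume form `ϖ` on the
set of regular points and that vanishes on the set of singular points. It depends on `|ϖ|` only,
hence not on the choice of the signs. -/
def poppMeasure [MeasurableSpace M] : Measure M := formMeasure S.poppForm

end

end SubRiemannianStructure
end SubRiemannian
end Popp
end

/-! At a regular point Popp's form is `h • Ω`, and the proof rests on the exact identity `h² * G =
n!`. Here `G` (`frameSum`) is the sum of the squares of `Ω` over the `n`-tuples of brackets of
length at most the step and of total length `Q` (`IsPoppFormAt.sq_mul_frameSum`).

The metric `g_p` is the minimal sum of squares of coefficients in the generating family, so this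
family is a Parseval frame of `𝒟_p`. Tensor powers of a Parseval frame are Parseval, and a quotient
norm is again a minimal-coefficient norm for the image of the frame. Hence the norm of the graded
space is the minimal-coefficient norm of the classes of the brackets (`isLeast_grSqNorm`). For such
a norm, Cauchy–Binet says that the squared determinants of all `n`-tuples of the family, taken in an
orthonormal basis, add up to `n!` (`sum_det_sq_of_isLeast`). A nonzero determinant forces exactly
`n_i` of the brackets to have length at most `i`, hence total length `Q`. For such tuples the lifts
of the classes may be replaced by the brackets themselves, because lower-order errors do not change
`Ω` (`alternating_eq_of_filtration`). Conversely `Q` is the least total length of a frame, so a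
tuple of total length `Q` on which `Ω` does not vanish has the same multiplicities
(`card_eq_of_sum_succ_eq`).

Near a regular point the step and `Q` are constant, and `G` with these numbers frozen is continuous;
hence so is `|h| = √(n!/G)`. Swapping two brackets shows that `ν` is also the maximum of `|Ω|`, so
`ν² ≤ G ≤ N ν²` with `N` a number of tuples. This number is bounded because the flag at a regular
point grows strictly until it fills the tangent space, whence the step is at most `n`. Both this
fact and the existence of the maps `π_i` come from constancy of rank: a field of `𝒟ⁱ` that vanishes
at a regular point `p` has its derivative there in `𝒟ⁱ_p` (`fderiv_chartRead_mem`). -/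

namespace Popp

/-! ### Parseval frames, minimal-coefficient norms and Cauchy–Binet. -/

section Parseval

variable {ι W V : Type*} [Fintype ι] [AddCommGroup W] [Module ℝ W] [AddCommGroup V] [Module ℝ V]

/-- `x` is a Parseval frame for the bilinear form `B`. -/
def IsParseval (B : LinearMap.BilinForm ℝ W) (x : ι → W) : Prop :=
  ∀ v, ∑ a, B v (x a) • x a = v

/-- The sums of squares of the coefficients of the expressions of `v` as a combination of the
vectors `x a`. -/
def coeffSq (x : ι → V) (v : V) : Set ℝ :=
  {t | ∃ u : ι → ℝ, v = ∑ a, u a • x a ∧ t = ∑ a, u a ^ 2}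

namespace IsParseval

variable {B : LinearMap.BilinForm ℝ W} {x : ι → W}

theorem apply_self (h : IsParseval B x) (v : W) : B v v = ∑ a, B v (x a) ^ 2 := by
  have : B v v = B v (∑ a, B v (x a) • x a) := by rw [h v]
  rw [this, map_sum]
  exact Finset.sum_congr rfl fun a _ => by rw [map_smul, smul_eq_mul, sq]

theorem apply_sum_le (h : IsParseval B x) (u : ι → ℝ) :
    B (∑ a, u a • x a) (∑ a, u a • x a) ≤ ∑ a, u a ^ 2 := by
  set e := ∑ a, u a • x a with he
  have h1 := h.apply_self e
  have h2 : B e e = ∑ a, u a * B e (x a) := by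
    have : B e e = B e (∑ a, u a • x a) := by rw [← he]
    rw [this, map_sum]
    simp
  -- Any coefficients of `e` are compared with the canonical ones `B e (x a)`; the cross term is `B
  -- e e` by `h2`.
  have h3 : 0 ≤ ∑ a, (u a - B e (x a)) ^ 2 := Finset.sum_nonneg fun a _ => sq_nonneg _
  have h4 : ∑ a, (u a - B e (x a)) ^ 2
      = ∑ a, u a ^ 2 - 2 * ∑ a, u a * B e (x a) + ∑ a, B e (x a) ^ 2 := by
    rw [Finset.mul_sum, ← Finset.sum_sub_distrib, ← Finset.sum_add_distrib]
    exact Finset.sum_congr rfl fun a _ => by ring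
  linarith

/-- The squared norm induced by a linear map is computed by any Parseval frame. -/
theorem sInf_eq (h : IsParseval B x) (f : W →ₗ[ℝ] V) {w : V}
    {t : ℝ} (ht : IsLeast (coeffSq (fun a => f (x a)) w) t) :
    sInf {t | ∃ e : W, f e = w ∧ t = B e e} = t := by
  -- Coefficients `u` give the preimage `∑ a, u a • x a`, of square at most `∑ u²`. A preimage `e`
  -- has the coefficients `B e (x a)`, with sum of squares exactly `B e e`. So the two minimisation
  -- problems have the same value.
  refine IsLeast.csInf_eq ⟨?_, ?_⟩
  · obtain ⟨u, hu, rfl⟩ := ht.1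
    refine ⟨∑ a, u a • x a, by simp [hu], le_antisymm ?_ (h.apply_sum_le u)⟩
    refine ht.2 ⟨fun a => B (∑ a, u a • x a) (x a), ?_, h.apply_self _⟩
    have h1 := congrArg f (h (∑ a, u a • x a))
    rw [map_sum] at h1
    simp only [map_smul _ (_ : ℝ) (x _)] at h1
    rw [h1, hu]
    simp
  · rintro _ ⟨e, rfl, rfl⟩
    refine ht.2 ⟨fun a => B e (x a), ?_, h.apply_self e⟩
    conv_lhs => rw [← h e]
    simp

/-- An equality of linear maps, hence checked on pure tensors, where it is the multilinear expansion
of `v j = ∑ a, B (v j) (x a) • x a` in every factor. -/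
theorem tensor (h : IsParseval B x) (i : ℕ) :
    IsParseval (tensorForm B i) (fun I : Fin i → ι => PiTensorProduct.tprod ℝ fun j => x (I j)) := by
  classical
  have key : (∑ I : Fin i → ι, LinearMap.toSpanSingleton ℝ _
      (PiTensorProduct.tprod ℝ fun j => x (I j)) ∘ₗ
        ((tensorForm B i).flip (PiTensorProduct.tprod ℝ fun j => x (I j)))) = LinearMap.id := by
    refine PiTensorProduct.ext (MultilinearMap.ext fun v => ?_)
    simp only [LinearMap.compMultilinearMap_apply, LinearMap.sum_apply, LinearMap.comp_apply,
      LinearMap.toSpanSingleton_apply, LinearMap.id_apply]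
    conv_rhs => rw [show v = fun j => ∑ a, B (v j) (x a) • x a from funext fun j => (h (v j)).symm]
    rw [MultilinearMap.map_sum]
    exact Finset.sum_congr rfl fun I _ => by
      rw [MultilinearMap.map_smul_univ]
      exact congrArg (· • _) (tensorForm_tprod B i v fun j => x (I j))
  intro v
  simpa [LinearMap.sum_apply] using LinearMap.congr_fun key v

end IsParseval

/-- First variation: if `u` is optimal for `v`, then `u + t • e_a` competes for `v + t • x a`. The
resulting quadratic inequality in `t` has no constant term, so its linear coefficient `2 (u a - B v
(x a))` must vanish. The optimal coefficients are therefore the values of `B`. -/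
theorem isParseval_of_isLeast {B : LinearMap.BilinForm ℝ W} (hB : ∀ v w, B v w = B w v) {x : ι → W}
    (h : ∀ v, IsLeast (coeffSq x v) (B v v)) : IsParseval B x := by
  classical
  intro v
  obtain ⟨u, hu, huv⟩ := (h v).1
  have key : ∀ a, B v (x a) = u a := by
    intro a
    have h1 : ∀ t : ℝ, 0 ≤ (1 - B (x a) (x a)) * (t * t) + (2 * (u a - B v (x a))) * t + 0 := by
      intro t
      have h2 := (h (v + t • x a)).2 ⟨u + t • Pi.single a 1, by
        simp [add_smul, Finset.sum_add_distrib, hu, Pi.single_apply], rfl⟩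
      have h3 : ∑ b, (u + t • (Pi.single a 1 : ι → ℝ)) b ^ 2
          = ∑ b, u b ^ 2 + 2 * t * u a + t ^ 2 := by
        have : ∀ b, (u + t • (Pi.single a 1 : ι → ℝ)) b ^ 2
            = u b ^ 2 + ((2 * t * u b) * (Pi.single a 1 : ι → ℝ) b
              + t ^ 2 * (Pi.single a 1 : ι → ℝ) b) := by
          intro b
          by_cases hb : b = a
          · subst hb; simp; ring
          · simp [hb]
        rw [Finset.sum_congr rfl fun b _ => this b]
        simp [Finset.sum_add_distrib, Pi.single_apply]
        ring
      rw [h3, ← huv] at h2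
      simp only [map_add, map_smul, LinearMap.add_apply, LinearMap.smul_apply, smul_eq_mul,
        hB (x a) v] at h2
      nlinarith
    have h4 := discrim_le_zero h1
    rw [discrim] at h4
    nlinarith [sq_nonneg (u a - B v (x a))]
  simp only [key]
  exact hu.symm

theorem exists_isLeast_coeffSq (x : ι → V) {v : V} (hv : v ∈ Submodule.span ℝ (Set.range x)) :
    ∃ t, IsLeast (coeffSq x v) t := by
  let f : EuclideanSpace ℝ ι →ₗ[ℝ] V :=
    Fintype.linearCombination ℝ x ∘ₗ (WithLp.linearEquiv 2 ℝ (ι → ℝ)).toLinearMap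
  have hf : ∀ u, f u = ∑ a, u a • x a := fun u => by simp [f, Fintype.linearCombination_apply]
  have hv' : v ∈ LinearMap.range f := by
    obtain ⟨c, hc⟩ := (Submodule.mem_span_range_iff_exists_fun ℝ).1 hv
    exact ⟨WithLp.toLp 2 c, by simpa [hf] using hc⟩
  refine ⟨inducedForm f ⟨v, hv'⟩ ⟨v, hv'⟩, ?_⟩
  convert inducedForm_isLeast f ⟨v, hv'⟩ using 1
  ext t
  constructor
  · rintro ⟨u, hu, rfl⟩
    exact ⟨WithLp.toLp 2 u, by simp [hf, hu], by rw [PiLp.inner_apply]; simp [sq]⟩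
  · rintro ⟨u, hu, rfl⟩
    exact ⟨u, by simpa [hf] using hu.symm, by rw [PiLp.inner_apply]; simp [sq]⟩

/-- The minimal sum of squares of coefficients is a Euclidean squared norm. -/
theorem exists_basis_isLeast_coeffSq {n : ℕ} (x : ι → V) (hx : Submodule.span ℝ (Set.range x) = ⊤)
    (hn : Module.finrank ℝ V = n) :
    ∃ b : Module.Basis (Fin n) ℝ V, ∀ c : Fin n → ℝ,
      IsLeast (coeffSq x (∑ k, c k • b k)) (∑ k, c k ^ 2) := by
  let f : EuclideanSpace ℝ ι →ₗ[ℝ] V :=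
    Fintype.linearCombination ℝ x ∘ₗ (WithLp.linearEquiv 2 ℝ (ι → ℝ)).toLinearMap
  have hf : ∀ u, f u = ∑ a, u a • x a := fun u => by simp [f, Fintype.linearCombination_apply]
  have hr : LinearMap.range f = ⊤ := by
    rw [eq_top_iff, ← hx, Submodule.span_le]
    rintro _ ⟨a, rfl⟩
    classical
    exact ⟨EuclideanSpace.single a 1, by simp [hf]⟩
  -- The optimal coefficient vectors are those orthogonal to the relations `ker f`, so the norm is
  -- the Euclidean norm of this complement.
  let e : (LinearMap.ker f)ᗮ ≃ₗ[ℝ] V :=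
    (f.kerComplementEquivRange (Submodule.isCompl_orthogonal _).symm).trans
      (LinearEquiv.ofTop _ hr)
  have he : ∀ u, e u = f u := fun u => rfl
  have hd : Module.finrank ℝ (LinearMap.ker f)ᗮ = n := by rw [e.finrank_eq, hn]
  let o := (stdOrthonormalBasis ℝ (LinearMap.ker f)ᗮ).reindex (finCongr hd)
  refine ⟨o.toBasis.map e, fun c => ?_⟩
  have h1 : ∑ k, c k • (o.toBasis.map e) k = e (∑ k, c k • o k) := by simp
  set w := ∑ k, c k • o k with hw
  have h2 : ∑ k, c k ^ 2 = inner ℝ w w := by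
    have : c = o.repr w := by
      ext k
      simp [hw, map_sum, map_smul, o.repr_self, Pi.single_apply]
    rw [← o.repr.inner_map_map w w, PiLp.inner_apply]
    refine Finset.sum_congr rfl fun k _ => ?_
    rw [← this]
    simp [sq]
  rw [h1, h2]
  constructor
  · refine ⟨(w : EuclideanSpace ℝ ι), by rw [he, hf], ?_⟩
    rw [Submodule.coe_inner, PiLp.inner_apply]
    simp [sq]
  · rintro _ ⟨u, hu, rfl⟩
    have hk : WithLp.toLp 2 u - (w : EuclideanSpace ℝ ι) ∈ LinearMap.ker f := by
      rw [LinearMap.mem_ker, map_sub, ← he, hu, hf]; simp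
    have h0 : inner ℝ (WithLp.toLp 2 u - (w : EuclideanSpace ℝ ι)) (w : EuclideanSpace ℝ ι) = 0 :=
      (Submodule.mem_orthogonal _ _).1 w.2 _ hk
    have h3 : (0 : ℝ) ≤ inner ℝ (WithLp.toLp 2 u - (w : EuclideanSpace ℝ ι))
      (WithLp.toLp 2 u - (w : EuclideanSpace ℝ ι)) := real_inner_self_nonneg
    have h4 : ∑ a, u a ^ 2 = inner ℝ (WithLp.toLp 2 u) (WithLp.toLp 2 u) := by
      rw [PiLp.inner_apply]; simp [sq]
    rw [h4, Submodule.coe_inner]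
    rw [inner_sub_left] at h0
    rw [inner_sub_left, inner_sub_right, inner_sub_right, real_inner_comm _ (w : EuclideanSpace ℝ ι)] at h3
    have h5 : inner ℝ (WithLp.toLp 2 u) (w : EuclideanSpace ℝ ι)
      = inner ℝ (w : EuclideanSpace ℝ ι) (WithLp.toLp 2 u) := real_inner_comm _ _
    linarith

/-- A family of vectors spread over the factors of a product. -/
theorem isLeast_coeffSq_single {κ : Type*} [Fintype κ] [DecidableEq κ] {ι : κ → Type*}
    [∀ i, Fintype (ι i)] {V : κ → Type*} [∀ i, AddCommGroup (V i)] [∀ i, Module ℝ (V i)]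
    (x : ∀ i, ι i → V i) (w : ∀ i, V i) (t : κ → ℝ) (h : ∀ i, IsLeast (coeffSq (x i) (w i)) (t i)) :
    IsLeast (coeffSq (fun a : Σ i, ι i => (Pi.single a.1 (x a.1 a.2) : ∀ i, V i)) w)
      (∑ i, t i) := by
  have key : ∀ u : (Σ i, ι i) → ℝ,
      ∑ a : Σ i, ι i, u a • (Pi.single a.1 (x a.1 a.2) : ∀ i, V i)
        = fun i => ∑ a, u ⟨i, a⟩ • x i a := by
    intro u
    rw [Fintype.sum_sigma]
    have : ∀ i, ∑ a, u ⟨i, a⟩ • (Pi.single i (x i a) : ∀ i, V i)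
        = Pi.single i (∑ a, u ⟨i, a⟩ • x i a) := by
      intro i
      have h := map_sum (LinearMap.single ℝ V i) (fun a => u ⟨i, a⟩ • x i a) Finset.univ
      simp only [LinearMap.single_apply] at h
      rw [h]
      exact Finset.sum_congr rfl fun a _ => by rw [← Pi.single_smul]
    simp only [this]
    exact Finset.univ_sum_single _
  constructor
  · choose u hu hut using fun i => (h i).1
    refine ⟨fun a => u a.1 a.2, ?_, ?_⟩
    · rw [key]
      exact funext hu
    · rw [Fintype.sum_sigma]
      exact Finset.sum_congr rfl fun i _ => hut i
  · rintro _ ⟨u, hu, rfl⟩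
    rw [Fintype.sum_sigma]
    rw [key] at hu
    exact Finset.sum_le_sum fun i _ => (h i).2 ⟨fun a => u ⟨i, a⟩, congrFun hu i, rfl⟩

/-- A form of the Cauchy–Binet formula. -/
theorem sum_det_sq_of_isLeast {n : ℕ} {x : ι → V} {b : Module.Basis (Fin n) ℝ V}
    (h : ∀ c : Fin n → ℝ, IsLeast (coeffSq x (∑ k, c k • b k)) (∑ k, c k ^ 2)) :
    ∑ I : Fin n → ι, b.det (fun k => x (I k)) ^ 2 = n.factorial := by
  classical
  let B : LinearMap.BilinForm ℝ V := ∑ k, (b.coord k).smulRight (b.coord k)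
  have hB : ∀ v w, B v w = ∑ k, b.repr v k * b.repr w k := fun v w => by
    simp [B, LinearMap.sum_apply]
  have hP : IsParseval B x := by
    refine isParseval_of_isLeast (fun v w => by simp [hB, mul_comm]) fun v => ?_
    have h1 := h (fun k => b.repr v k)
    rw [b.sum_repr] at h1
    simpa [hB, sq] using h1
  have hb : ∀ k, ∑ a, b.repr (x a) k • x a = b k := fun k => by
    have := hP (b k)
    simpa [hB, Finsupp.single_apply] using this
  -- The determinant of the permuted basis is expanded through `hb`. Summing against `sign σ`
  -- afterwards turns the product of coordinates into a second copy of the determinant of `x ∘ I`,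
  -- by the Leibniz formula.
  have h1 : ∀ σ : Equiv.Perm (Fin n), ((Equiv.Perm.sign σ : ℤ) : ℝ)
      = ∑ I : Fin n → ι, (∏ k, b.repr (x (I k)) (σ k)) * b.det (fun k => x (I k)) := by
    intro σ
    have h2 : b.det (fun k => b (σ k)) = ((Equiv.Perm.sign σ : ℤ) : ℝ) := by
      have := b.det.map_perm b σ
      rw [b.det_self] at this
      simpa [Function.comp_def, Units.smul_def] using this
    rw [← h2, show (fun k => b (σ k)) = fun k => ∑ a, b.repr (x a) (σ k) • x a from
      funext fun k => (hb _).symm]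
    change b.det.toMultilinearMap _ = _
    rw [MultilinearMap.map_sum]
    exact Finset.sum_congr rfl fun I _ => by rw [MultilinearMap.map_smul_univ]; rfl
  have h3 : ∑ σ : Equiv.Perm (Fin n), ((Equiv.Perm.sign σ : ℤ) : ℝ) * (Equiv.Perm.sign σ : ℤ)
      = n.factorial := by
    have : ∀ σ : Equiv.Perm (Fin n),
        ((Equiv.Perm.sign σ : ℤ) : ℝ) * (Equiv.Perm.sign σ : ℤ) = 1 := fun σ => by
      rcases Int.units_eq_one_or (Equiv.Perm.sign σ) with h | h <;> simp [h]
    simp [this, Fintype.card_perm]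
  rw [← h3]
  have h4 : ∀ σ : Equiv.Perm (Fin n), ((Equiv.Perm.sign σ : ℤ) : ℝ) * (Equiv.Perm.sign σ : ℤ)
      = ((Equiv.Perm.sign σ : ℤ) : ℝ) *
        ∑ I : Fin n → ι, (∏ k, b.repr (x (I k)) (σ k)) * b.det (fun k => x (I k)) :=
    fun σ => congrArg _ (h1 σ)
  rw [Finset.sum_congr rfl fun σ _ => h4 σ]
  simp only [Finset.mul_sum]
  rw [Finset.sum_comm]
  refine Finset.sum_congr rfl fun I _ => ?_
  simp only [← mul_assoc]
  rw [← Finset.sum_mul, sq]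
  congr 1
  rw [Module.Basis.det_apply, Matrix.det_apply]
  simp [Module.Basis.toMatrix_apply, Units.smul_def]

end Parseval

/-! ### Weights of a frame with respect to a filtration. -/

section Filtration

theorem card_le_finrank_of_linearIndependent {κ V : Type*} [AddCommGroup V]
    [Module ℝ V] [FiniteDimensional ℝ V] {v : κ → V} (hv : LinearIndependent ℝ v)
    (E : Submodule ℝ V) (s : Finset κ) (hs : ∀ k ∈ s, v k ∈ E) :
    s.card ≤ Module.finrank ℝ E := by
  have h1 : LinearIndependent ℝ (fun k : s => (⟨v k, hs k k.2⟩ : E)) :=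
    LinearIndependent.of_comp E.subtype (hv.comp _ Subtype.val_injective)
  simpa using h1.fintype_card_le_finrank

/-- An alternating form of top degree does not change when its arguments change modulo smaller
terms of a filtration, if the arguments are numerous enough in each term of the filtration. -/
theorem alternating_eq_of_filtration {n : ℕ} {V : Type*} [AddCommGroup V] [Module ℝ V]
    [FiniteDimensional ℝ V] {E : ℕ → Submodule ℝ V} (hE : Monotone E) (Φ : V [⋀^Fin n]→ₗ[ℝ] ℝ)
    (ℓ : Fin n → ℕ) {v v' : Fin n → V} (hv : ∀ k, v k ∈ E (ℓ k + 1))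
    (hvv : ∀ k, v k - v' k ∈ E (ℓ k))
    (hN : ∀ k, Module.finrank ℝ (E (ℓ k)) ≤ (Finset.univ.filter fun j => ℓ j < ℓ k).card) :
    Φ v = Φ v' := by
  classical
  have hv' : ∀ k, v' k ∈ E (ℓ k + 1) := fun k => by
    have := sub_mem (hv k) (hE (Nat.le_succ _) (hvv k))
    simpa using this
  suffices h : ∀ s : Finset (Fin n), Φ (s.piecewise v' v) = Φ v by
    have := h Finset.univ
    rw [Finset.piecewise_univ] at this
    exact this.symm
  intro s
  induction s using Finset.induction_on with
  | empty => rw [Finset.piecewise_empty]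
  | insert k s hk ih =>
    set u := s.piecewise v' v with hu
    have hu1 : ∀ j, u j ∈ E (ℓ j + 1) := fun j => by
      by_cases hj : j ∈ s
      · simpa [hu, hj] using hv' j
      · simpa [hu, hj] using hv j
    have huk : Function.update u k (v k) = u := by
      rw [Function.update_eq_iff]
      simp [hu, hk]
    rw [Finset.piecewise_insert, ← ih, ← sub_eq_zero, ← neg_eq_zero, neg_sub]
    conv_lhs => rw [← hu, ← huk]
    simp only [Function.update_idem]
    rw [← AlternatingMap.map_update_sub]
    -- The entry `v k - v' k` and the entries of weight below `ℓ k` all lie in `E (ℓ k)`, and by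
    -- `hN` they are too many to be independent there.
    refine AlternatingMap.map_linearDependent _ _ fun hli => ?_
    have h1 := card_le_finrank_of_linearIndependent hli (E (ℓ k))
      (insert k (Finset.univ.filter fun j => ℓ j < ℓ k)) (by
        intro j hj
        rcases eq_or_ne j k with rfl | hjk
        · simpa using hvv j
        · rw [Function.update_of_ne hjk]
          have : ℓ j < ℓ k := by simpa [hjk] using hj
          exact hE this (hu1 j))
    rw [Finset.card_insert_of_notMem (by simp)] at h1
    have := hN k
    omega

/-- Abel summation: it rewrites `Q` as a sum of codimensions, which can be compared term by term
with counts of vectors. -/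
theorem sum_succ_mul_sub_eq (g : ℕ → ℤ) (r : ℕ) :
    ∑ i ∈ Finset.range r, ((i : ℤ) + 1) * (g (i + 1) - g i)
      = ∑ i ∈ Finset.range r, (g r - g i) := by
  induction r with
  | zero => simp
  | succ r ih =>
    rw [Finset.sum_range_succ, ih, Finset.sum_range_succ]
    have : ∑ i ∈ Finset.range r, (g (r + 1) - g i)
        = ∑ i ∈ Finset.range r, (g r - g i) + r * (g (r + 1) - g r) := by
      rw [← sub_eq_iff_eq_add', ← Finset.sum_sub_distrib]
      simp [mul_sub]
    rw [this]
    ring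

/-- Double counting of the pairs `(k, i)` with `i < r` and `i ≤ ℓ k`. The truncation at `r` accounts
for brackets longer than the step. -/
theorem sum_min_eq {n : ℕ} (ℓ : Fin n → ℕ) (r : ℕ) :
    ((∑ k, min (ℓ k + 1) r : ℕ) : ℤ)
      = ∑ i ∈ Finset.range r, ((n : ℤ) - (Finset.univ.filter fun k => ℓ k < i).card) := by
  have h1 : ∀ k, min (ℓ k + 1) r = ((Finset.range r).filter fun i => ¬ ℓ k < i).card := by
    intro k
    rw [show (Finset.range r).filter (fun i => ¬ ℓ k < i) = Finset.range (min (ℓ k + 1) r) by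
      ext i; simp; omega, Finset.card_range]
  have h2 : ∀ i, ((n : ℤ) - (Finset.univ.filter fun k => ℓ k < i).card)
      = ((Finset.univ.filter fun k => ¬ ℓ k < i).card : ℕ) := by
    intro i
    have := Finset.card_filter_add_card_filter_not (s := (Finset.univ : Finset (Fin n)))
      (fun k => ℓ k < i)
    rw [Finset.card_univ, Fintype.card_fin] at this
    omega
  rw [Finset.sum_congr rfl fun i _ => h2 i, ← Nat.cast_sum]
  congr 1
  simp only [h1, Finset.card_filter]
  exact Finset.sum_comm

variable {n r : ℕ} {ℓ : Fin n → ℕ} {g : ℕ → ℕ}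

theorem sum_succ_eq_of_card_eq (hr : g r = n) (hℓ : ∀ k, ℓ k < r)
    (hN : ∀ i < r, (Finset.univ.filter fun k => ℓ k < i).card = g i) :
    ((∑ k, (ℓ k + 1) : ℕ) : ℤ)
      = ∑ i ∈ Finset.range r, ((i : ℤ) + 1) * ((g (i + 1) : ℤ) - g i) := by
  rw [sum_succ_mul_sub_eq (fun i => (g i : ℤ)), hr,
    show ∑ k, (ℓ k + 1) = ∑ k, min (ℓ k + 1) r from
      Finset.sum_congr rfl fun k _ => (min_eq_left (hℓ k)).symm, sum_min_eq]
  exact Finset.sum_congr rfl fun i hi => by rw [hN i (Finset.mem_range.1 hi)]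

/-- Minimality of `Q`: since the counts are at most `g i`, one has `Q ≤ ∑ min (ℓ k + 1) r ≤ ∑ (ℓ k +
1)`. Equality of the ends forces equality in every term of both comparisons. -/
theorem card_eq_of_sum_succ_eq (hr : g r = n)
    (hN : ∀ i < r, (Finset.univ.filter fun k => ℓ k < i).card ≤ g i)
    (h : ((∑ k, (ℓ k + 1) : ℕ) : ℤ)
      = ∑ i ∈ Finset.range r, ((i : ℤ) + 1) * ((g (i + 1) : ℤ) - g i)) :
    (∀ k, ℓ k < r) ∧ ∀ i < r, (Finset.univ.filter fun k => ℓ k < i).card = g i := by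
  rw [sum_succ_mul_sub_eq (fun i => (g i : ℤ)), hr] at h
  have h1 : ∑ k, min (ℓ k + 1) r ≤ ∑ k, (ℓ k + 1) :=
    Finset.sum_le_sum fun k _ => min_le_left _ _
  have h2 : ∑ i ∈ Finset.range r, ((n : ℤ) - g i)
      ≤ ∑ i ∈ Finset.range r, ((n : ℤ) - (Finset.univ.filter fun k => ℓ k < i).card) :=
    Finset.sum_le_sum fun i hi => by have := hN i (Finset.mem_range.1 hi); omega
  have h3 := sum_min_eq ℓ r
  constructor
  · have h4 : ∑ k, min (ℓ k + 1) r = ∑ k, (ℓ k + 1) := by omega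
    have h5 := (Finset.sum_eq_sum_iff_of_le fun k _ => min_le_left (ℓ k + 1) r).1 h4
    intro k
    have := h5 k (Finset.mem_univ _)
    omega
  · have h4 : ∑ i ∈ Finset.range r, ((n : ℤ) - g i)
      = ∑ i ∈ Finset.range r, ((n : ℤ) - (Finset.univ.filter fun k => ℓ k < i).card) := by omega
    have h5 := (Finset.sum_eq_sum_iff_of_le fun i hi => by
      have := hN i (Finset.mem_range.1 hi); omega).1 h4
    intro i hi
    have := h5 i (Finset.mem_range.2 hi)
    omega

end Filtration

/-! ### Calculus of Lie brackets of smooth fields. -/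

section VectorFields

variable {n : ℕ} {M : Type*} [TopologicalSpace M] [ChartedSpace (EuclideanSpace ℝ (Fin n)) M]
  [IsManifold (𝓡 n) ∞ M] {V W Z : VField n M} {c : M → ℝ}

namespace VField.Smooth

theorem mdifferentiableAt (hV : V.Smooth) (x : M) :
    MDifferentiableAt (𝓡 n) (𝓡 n).tangent (fun x => (⟨x, V x⟩ : TangentBundle (𝓡 n) M)) x :=
  ContMDiffAt.mdifferentiableAt (hV x) (by simp)

theorem mlieBracket (hV : V.Smooth) (hW : W.Smooth) :
    VField.Smooth (VectorField.mlieBracket (𝓡 n) V W) := by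
  have : IsManifold (𝓡 n) (((⊤ : ℕ∞) : WithTop ℕ∞) + 1) M := by
    simpa using (inferInstance : IsManifold (𝓡 n) ∞ M)
  have : IsManifold (𝓡 n) (minSmoothness ℝ 2) M := by
    rw [minSmoothness_of_isRCLikeNormedField]; infer_instance
  refine ContDiff.mlieBracket_vectorField (m := ⊤) (n := ⊤) hV hW ?_
  simp

theorem fun_smul (hc : ContMDiff (𝓡 n) 𝓘(ℝ, ℝ) ∞ c) (hV : V.Smooth) : VField.Smooth (c • V) :=
  ContMDiff.smul_section hc hV

end VField.Smooth

variable (n M) in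
/-- The real vector space of smooth vector fields. -/
def smoothFields : Submodule ℝ (VField n M) where
  carrier := {V | V.Smooth}
  zero_mem' := Bundle.contMDiff_zeroSection ℝ (TangentSpace (𝓡 n) (M := M))
  add_mem' hV hW := ContMDiff.add_section hV hW
  smul_mem' _ _ hV := ContMDiff.const_smul_section hV

theorem mlieBracket_add_left (hV : V.Smooth) (hW : W.Smooth) :
    VectorField.mlieBracket (𝓡 n) (V + W) Z
      = VectorField.mlieBracket (𝓡 n) V Z + VectorField.mlieBracket (𝓡 n) W Z :=
  funext fun x =>
    VectorField.mlieBracket_add_left (hV.mdifferentiableAt x) (hW.mdifferentiableAt x)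

theorem mlieBracket_add_right (hV : V.Smooth) (hW : W.Smooth) :
    VectorField.mlieBracket (𝓡 n) Z (V + W)
      = VectorField.mlieBracket (𝓡 n) Z V + VectorField.mlieBracket (𝓡 n) Z W :=
  funext fun x =>
    VectorField.mlieBracket_add_right (hV.mdifferentiableAt x) (hW.mdifferentiableAt x)

theorem mlieBracket_const_smul_left (a : ℝ) (hV : V.Smooth) :
    VectorField.mlieBracket (𝓡 n) (a • V) Z = a • VectorField.mlieBracket (𝓡 n) V Z :=
  funext fun x => VectorField.mlieBracket_const_smul_left (hV.mdifferentiableAt x)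

theorem mlieBracket_const_smul_right (a : ℝ) (hV : V.Smooth) :
    VectorField.mlieBracket (𝓡 n) Z (a • V) = a • VectorField.mlieBracket (𝓡 n) Z V :=
  funext fun x => VectorField.mlieBracket_const_smul_right (hV.mdifferentiableAt x)

/-- The Lie bracket as a bilinear map on smooth vector fields. -/
noncomputable def bracketₗ :
    smoothFields n M →ₗ[ℝ] smoothFields n M →ₗ[ℝ] smoothFields n M :=
  LinearMap.mk₂ ℝ (fun V W => ⟨VectorField.mlieBracket (𝓡 n) V W, V.2.mlieBracket W.2⟩)
    (fun V V' _ => Subtype.ext (mlieBracket_add_left V.2 V'.2))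
    (fun a V _ => Subtype.ext (mlieBracket_const_smul_left a V.2))
    (fun _ W W' => Subtype.ext (mlieBracket_add_right W.2 W'.2))
    (fun a _ W => Subtype.ext (mlieBracket_const_smul_right a W.2))

@[simp] theorem coe_bracketₗ (V W : smoothFields n M) :
    (bracketₗ V W : VField n M) = VectorField.mlieBracket (𝓡 n) V W := rfl

theorem jacobi (hV : V.Smooth) (hW : W.Smooth) (hZ : Z.Smooth) :
    VectorField.mlieBracket (𝓡 n) (VectorField.mlieBracket (𝓡 n) V W) Z
      = VectorField.mlieBracket (𝓡 n) V (VectorField.mlieBracket (𝓡 n) W Z)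
        - VectorField.mlieBracket (𝓡 n) W (VectorField.mlieBracket (𝓡 n) V Z) := by
  have : IsManifold (𝓡 n) (minSmoothness ℝ 3) M := by
    rw [minSmoothness_of_isRCLikeNormedField]; infer_instance
  have h : minSmoothness ℝ 2 ≤ (∞ : WithTop ℕ∞) := by
    rw [minSmoothness_of_isRCLikeNormedField]
    exact ENat.LEInfty.out
  rw [VectorField.leibniz_identity_mlieBracket (ContMDiff.of_le hV h) (ContMDiff.of_le hW h)
    (ContMDiff.of_le hZ h)]
  simp

/-- The derivative of the function `c` along the vector field `V`. -/
noncomputable def derivAlong (V : VField n M) (c : M → ℝ) : M → ℝ :=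
  fun x => mfderiv (𝓡 n) 𝓘(ℝ, ℝ) c x (V x)

theorem contMDiff_derivAlong (hc : ContMDiff (𝓡 n) 𝓘(ℝ, ℝ) ∞ c) (hV : V.Smooth) :
    ContMDiff (𝓡 n) 𝓘(ℝ, ℝ) ∞ (derivAlong V c) := by
  have h1 : ContMDiff (𝓡 n).tangent 𝓘(ℝ, ℝ).tangent ∞ (tangentMap (𝓡 n) 𝓘(ℝ, ℝ) c) :=
    hc.contMDiff_tangentMap (by simp)
  exact (contMDiff_snd_tangentBundle_modelSpace ℝ 𝓘(ℝ, ℝ)).comp (h1.comp hV)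

theorem mlieBracket_fun_smul_right (hc : ContMDiff (𝓡 n) 𝓘(ℝ, ℝ) ∞ c) (hW : W.Smooth) :
    VectorField.mlieBracket (𝓡 n) V (c • W)
      = derivAlong V c • W
        + c • VectorField.mlieBracket (𝓡 n) V W :=
  funext fun x => VectorField.mlieBracket_smul_right
    (ContMDiffAt.mdifferentiableAt (hc x) (by simp)) (hW.mdifferentiableAt x)

theorem mlieBracket_fun_smul_left (hc : ContMDiff (𝓡 n) 𝓘(ℝ, ℝ) ∞ c) (hV : V.Smooth) :
    VectorField.mlieBracket (𝓡 n) (c • V) W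
      = - derivAlong W c • V
        + c • VectorField.mlieBracket (𝓡 n) V W :=
  funext fun x => VectorField.mlieBracket_smul_left
    (ContMDiffAt.mdifferentiableAt (hc x) (by simp)) (hV.mdifferentiableAt x)

/-- The iterated bracket of smooth vector fields, as a multilinear map. -/
noncomputable def iteratedBracketₗ : (i : ℕ) →
    MultilinearMap ℝ (fun _ : Fin (i + 1) => smoothFields n M) (smoothFields n M)
  | 0 => MultilinearMap.ofSubsingleton ℝ _ _ (0 : Fin 1) LinearMap.id
  | i + 1 => LinearMap.uncurryLeft
      (M := fun _ : Fin (i + 2) => smoothFields n M)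
      { toFun := fun V => (bracketₗ V).compMultilinearMap (iteratedBracketₗ i)
        map_add' := fun V W => by ext1 v; simp
        map_smul' := fun a V => by ext1 v; simp }

theorem coe_iteratedBracketₗ (i : ℕ) (V : Fin (i + 1) → smoothFields n M) :
    (iteratedBracketₗ i V : VField n M) = iteratedBracket (List.ofFn fun j => (V j : VField n M)) := by
  induction i with
  | zero => rfl
  | succ i ih =>
    rw [List.ofFn_succ, List.ofFn_succ]
    change VectorField.mlieBracket (𝓡 n) (V 0 : VField n M) (iteratedBracketₗ i (Fin.tail V) : VField n M) = _
    rw [ih, List.ofFn_succ]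
    rfl

theorem iteratedBracket_smooth : ∀ l : List (VField n M), (∀ V ∈ l, VField.Smooth V) →
    VField.Smooth (iteratedBracket l)
  | [], _ => (smoothFields n M).zero_mem
  | [V], h => h V (by simp)
  | V :: W :: l, h => (h V (by simp)).mlieBracket
      (iteratedBracket_smooth (W :: l) fun Z hZ => h Z (List.mem_cons_of_mem _ hZ))

end VectorFields

/-! ### The flag in terms of a generating family. -/

section Flag

variable {n : ℕ} {M : Type*} [TopologicalSpace M] [ChartedSpace (EuclideanSpace ℝ (Fin n)) M]
  [IsManifold (𝓡 n) ∞ M]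
  {F : Type*} [NormedAddCommGroup F] [NormedSpace ℝ F]
  {U : M → Type*} [TopologicalSpace (TotalSpace F U)]
  [∀ x, NormedAddCommGroup (U x)] [∀ x, InnerProductSpace ℝ (U x)]
  [FiberBundle F U] [VectorBundle ℝ F U]
  {S : SubRiemannianStructure n F U} {m : ℕ} {X : Fin m → VField n M}

theorem SubRiemannianStructure.mlieBracket_mem_flag_succ {V W : VField n M}
    (hV : V ∈ S.horizontal) {i : ℕ} (hW : W ∈ S.flag i) :
    VectorField.mlieBracket (𝓡 n) V W ∈ S.flag (i + 1) := by
  cases i with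
  | zero =>
    rw [SubRiemannianStructure.flag, Submodule.mem_bot] at hW
    rw [hW, VectorField.mlieBracket_zero_right]
    exact Submodule.zero_mem _
  | succ i =>
    exact Submodule.mem_sup_right (Submodule.subset_span ⟨V, hV, W, hW, rfl⟩)

variable (S) in
theorem SubRiemannianStructure.flag_mono : Monotone S.flag := by
  refine monotone_nat_of_le_succ fun i => ?_
  match i with
  | 0 => exact bot_le
  | i + 1 => exact le_sup_left

variable (S) in
theorem SubRiemannianStructure.flagAt_mono (p : M) : Monotone fun i => S.flagAt i p :=
  fun _ _ h => Submodule.map_mono (S.flag_mono h)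

theorem SubRiemannianStructure.apply_mem_flagAt {i : ℕ} {V : VField n M} (hV : V ∈ S.flag i)
    (p : M) : V p ∈ S.flagAt i p :=
  ⟨V, hV, rfl⟩

variable (S) in
theorem SubRiemannianStructure.flagAt_zero (p : M) : S.flagAt 0 p = ⊥ := by
  simp [SubRiemannianStructure.flagAt, SubRiemannianStructure.flag]

theorem SubRiemannianStructure.iteratedBracket_mem_flag : ∀ l : List (VField n M),
    (∀ V ∈ l, V ∈ S.horizontal) → iteratedBracket l ∈ S.flag l.length
  | [], _ => Submodule.zero_mem _
  | [V], h => h V (by simp)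
  | V :: W :: l, h => SubRiemannianStructure.mlieBracket_mem_flag_succ (h V (by simp))
      (SubRiemannianStructure.iteratedBracket_mem_flag (W :: l)
        fun Z hZ => h Z (List.mem_cons_of_mem _ hZ))

namespace SubRiemannianStructure.IsGeneratingFamily

theorem horizontal_le_smoothFields (hX : S.IsGeneratingFamily X) :
    S.horizontal ≤ smoothFields n M := by
  intro V hV
  obtain ⟨c, hc, hVc⟩ := (hX.mem_iff V).1 hV
  have : V = ∑ a, c a • X a := by ext1 x; simp [hVc x]
  rw [this]
  exact Submodule.sum_mem _ fun a _ => (hX.smooth a).fun_smul (hc a)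

theorem flag_le_smoothFields (hX : S.IsGeneratingFamily X) : ∀ i, S.flag i ≤ smoothFields n M
  | 0 => bot_le
  | 1 => hX.horizontal_le_smoothFields
  | i + 2 => by
    refine sup_le (hX.flag_le_smoothFields (i + 1)) (Submodule.span_le.2 ?_)
    rintro _ ⟨V, hV, W, hW, rfl⟩
    exact VField.Smooth.mlieBracket (hX.horizontal_le_smoothFields hV)
      (hX.flag_le_smoothFields (i + 1) hW)

theorem mem_horizontal (hX : S.IsGeneratingFamily X) (a : Fin m) : X a ∈ S.horizontal := by
  classical
  refine (hX.mem_iff _).2 ⟨fun b _ => if b = a then 1 else 0, fun b => contMDiff_const, fun x => ?_⟩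
  simp

theorem smooth_iteratedBracket (hX : S.IsGeneratingFamily X) (I : List (Fin m)) :
    VField.Smooth (iteratedBracket (I.map X)) :=
  iteratedBracket_smooth _ fun V hV => by
    obtain ⟨a, -, rfl⟩ := List.mem_map.1 hV
    exact hX.smooth a

theorem iteratedBracket_mem_flag (hX : S.IsGeneratingFamily X) {I : List (Fin m)} {i : ℕ}
    (hI : I.length ≤ i) : iteratedBracket (I.map X) ∈ S.flag i := by
  have h := SubRiemannianStructure.iteratedBracket_mem_flag (S := S) (I.map X) fun V hV => by
    obtain ⟨a, -, rfl⟩ := List.mem_map.1 hV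
    exact hX.mem_horizontal a
  rw [List.length_map] at h
  exact S.flag_mono hI h

/-- The fields of `𝒟ⁱ` are combinations, with smooth coefficients, of the brackets of length at
most `i`. -/
theorem flag_le_span (hX : S.IsGeneratingFamily X) (i : ℕ) :
    S.flag i ≤ Submodule.span ℝ {Z | ∃ (c : M → ℝ) (I : List (Fin m)),
      ContMDiff (𝓡 n) 𝓘(ℝ, ℝ) ∞ c ∧ I ≠ [] ∧ I.length ≤ i ∧ Z = c • iteratedBracket (I.map X)} := by
  have h1 : S.horizontal ≤ Submodule.span ℝ {Z | ∃ (c : M → ℝ) (a : Fin m),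
      ContMDiff (𝓡 n) 𝓘(ℝ, ℝ) ∞ c ∧ Z = c • X a} := by
    intro V hV
    obtain ⟨c, hc, hVc⟩ := (hX.mem_iff V).1 hV
    have : V = ∑ a, c a • X a := by ext1 x; simp [hVc x]
    rw [this]
    exact Submodule.sum_mem _ fun a _ => Submodule.subset_span ⟨c a, a, hc a, rfl⟩
  induction i with
  | zero => exact bot_le
  | succ i ih =>
    cases i with
    | zero =>
      refine h1.trans (Submodule.span_mono ?_)
      rintro _ ⟨c, a, hc, rfl⟩
      exact ⟨c, [a], hc, by simp, by simp, rfl⟩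
    | succ i =>
      refine sup_le (ih.trans (Submodule.span_mono ?_)) (Submodule.span_le.2 ?_)
      · rintro _ ⟨c, I, hc, hI, hIl, rfl⟩
        exact ⟨c, I, hc, hI, hIl.trans (Nat.le_succ _), rfl⟩
      · rintro _ ⟨V, hV, W, hW, rfl⟩
        have hVs := hX.horizontal_le_smoothFields hV
        replace hV := h1 hV
        replace hW := ih hW
        set P := Submodule.span ℝ {Z : VField n M | ∃ (c : M → ℝ) (I : List (Fin m)),
          ContMDiff (𝓡 n) 𝓘(ℝ, ℝ) ∞ c ∧ I ≠ [] ∧ I.length ≤ i + 1 + 1 ∧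
            Z = c • iteratedBracket (I.map X)} with hP
        have hsm : ∀ (c : M → ℝ) (I : List (Fin m)), ContMDiff (𝓡 n) 𝓘(ℝ, ℝ) ∞ c →
            VField.Smooth (c • iteratedBracket (I.map X)) := fun c I hc =>
          (hX.smooth_iteratedBracket I).fun_smul hc
        -- By the Leibniz rules `[c X_a, d Y_I]` is a combination, with smooth coefficients, of
        -- `X_a`, `Y_I` and `[X_a, Y_I]`.
        have key : ∀ (c d : M → ℝ) (a : Fin m) (I : List (Fin m)),
            ContMDiff (𝓡 n) 𝓘(ℝ, ℝ) ∞ c → ContMDiff (𝓡 n) 𝓘(ℝ, ℝ) ∞ d → I ≠ [] →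
            I.length ≤ i + 1 →
            VectorField.mlieBracket (𝓡 n) (c • X a) (d • iteratedBracket (I.map X)) ∈ P := by
          intro c d a I hc hd hI hIl
          have hY := hX.smooth_iteratedBracket I
          rw [mlieBracket_fun_smul_left hc (hX.smooth a), mlieBracket_fun_smul_right hd hY]
          refine P.add_mem ?_ ?_
          · refine Submodule.subset_span ⟨_, [a], (contMDiff_derivAlong hc (hY.fun_smul hd)).neg,
              by simp, by simp, rfl⟩
          · rw [smul_add, smul_smul, smul_smul]
            refine P.add_mem (Submodule.subset_span ⟨_, I, hc.mul (contMDiff_derivAlong hd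
              (hX.smooth a)), hI, hIl.trans (Nat.le_succ _), rfl⟩)
              (Submodule.subset_span ⟨_, a :: I, hc.mul hd, by simp, by simpa using hIl, ?_⟩)
            cases I with
            | nil => exact absurd rfl hI
            | cons b I => rfl
        have hW2 : ∀ (c : M → ℝ) (a : Fin m), ContMDiff (𝓡 n) 𝓘(ℝ, ℝ) ∞ c →
            W.Smooth ∧ VectorField.mlieBracket (𝓡 n) (c • X a) W ∈ P := by
          intro c a hc
          -- Smoothness is carried through the induction because the additivity of the bracket is
          -- available for smooth fields only.
          refine Submodule.span_induction (p := fun W _ => VField.Smooth W ∧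
            VectorField.mlieBracket (𝓡 n) (c • X a) W ∈ P) ?_ ?_ ?_ ?_ hW
          · rintro _ ⟨d, I, hd, hI, hIl, rfl⟩
            exact ⟨hsm d I hd, key c d a I hc hd hI hIl⟩
          · exact ⟨(smoothFields n M).zero_mem, by
              rw [VectorField.mlieBracket_zero_right]; exact P.zero_mem⟩
          · rintro W W' - - ⟨h1, h2⟩ ⟨h3, h4⟩
            exact ⟨(smoothFields n M).add_mem h1 h3, by
              rw [mlieBracket_add_right h1 h3]; exact P.add_mem h2 h4⟩
          · rintro t W - ⟨h1, h2⟩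
            exact ⟨(smoothFields n M).smul_mem t h1, by
              rw [mlieBracket_const_smul_right t h1]; exact P.smul_mem t h2⟩
        refine (Submodule.span_induction (p := fun V _ => VField.Smooth V ∧
            VectorField.mlieBracket (𝓡 n) V W ∈ P) ?_ ?_ ?_ ?_ hV).2
        · rintro _ ⟨c, a, hc, rfl⟩
          exact ⟨(hX.smooth a).fun_smul hc, (hW2 c a hc).2⟩
        · exact ⟨(smoothFields n M).zero_mem, by
            rw [VectorField.mlieBracket_zero_left]; exact P.zero_mem⟩
        · rintro V V' - - ⟨h1, h2⟩ ⟨h3, h4⟩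
          exact ⟨(smoothFields n M).add_mem h1 h3, by
            rw [mlieBracket_add_left h1 h3]; exact P.add_mem h2 h4⟩
        · rintro t V - ⟨h1, h2⟩
          exact ⟨(smoothFields n M).smul_mem t h1, by
            rw [mlieBracket_const_smul_left t h1]; exact P.smul_mem t h2⟩

theorem flagAt_eq_span (hX : S.IsGeneratingFamily X) (i : ℕ) (p : M) :
    S.flagAt i p = Submodule.span ℝ
      {v | ∃ I : List (Fin m), I ≠ [] ∧ I.length ≤ i ∧ v = iteratedBracket (I.map X) p} := by
  apply le_antisymm
  · refine (Submodule.map_mono (hX.flag_le_span i)).trans ?_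
    rw [Submodule.map_span, Submodule.span_le]
    rintro _ ⟨_, ⟨c, I, hc, hI, hIl, rfl⟩, rfl⟩
    exact Submodule.smul_mem _ (c p) (Submodule.subset_span ⟨I, hI, hIl, rfl⟩)
  · rw [Submodule.span_le]
    rintro _ ⟨I, hI, hIl, rfl⟩
    exact apply_mem_flagAt (hX.iteratedBracket_mem_flag hIl) p

/-- The flag is built with horizontal fields in the left slot. Jacobi takes a bracket `[C, D]` out
of that slot, and the induction on `i` is uniform in `j` so that it applies to `D` against both `W`
and `[C, W]`. -/
theorem mlieBracket_mem_flag (hX : S.IsGeneratingFamily X) {i j : ℕ} {V W : VField n M}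
    (hV : V ∈ S.flag i) (hW : W ∈ S.flag j) :
    VectorField.mlieBracket (𝓡 n) V W ∈ S.flag (i + j) := by
  induction i generalizing j V W with
  | zero =>
    rw [SubRiemannianStructure.flag, Submodule.mem_bot] at hV
    rw [hV, VectorField.mlieBracket_zero_left]
    exact Submodule.zero_mem _
  | succ i ih =>
    cases i with
    | zero =>
      rw [Nat.add_comm]
      exact mlieBracket_mem_flag_succ hV hW
    | succ i =>
      have hWs := hX.flag_le_smoothFields _ hW
      obtain ⟨A, hA, B, hB, rfl⟩ := Submodule.mem_sup.1 hV
      have hAs := hX.flag_le_smoothFields _ hA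
      have hBs : VField.Smooth B ∧ VectorField.mlieBracket (𝓡 n) B W ∈ S.flag (i + 1 + 1 + j) := by
        refine Submodule.span_induction (p := fun V _ => VField.Smooth V ∧
            VectorField.mlieBracket (𝓡 n) V W ∈ S.flag (i + 1 + 1 + j)) ?_ ?_ ?_ ?_ hB
        · rintro _ ⟨C, hC, D, hD, rfl⟩
          have hCs := hX.horizontal_le_smoothFields hC
          have hDs := hX.flag_le_smoothFields _ hD
          refine ⟨VField.Smooth.mlieBracket hCs hDs, ?_⟩
          rw [jacobi hCs hDs hWs]
          refine Submodule.sub_mem _ ?_ ?_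
          · have := mlieBracket_mem_flag_succ hC (ih hD hW)
            rwa [show i + 1 + j + 1 = i + 1 + 1 + j by ring] at this
          · have := ih hD (mlieBracket_mem_flag_succ hC hW)
            rwa [show i + 1 + (j + 1) = i + 1 + 1 + j by ring] at this
        · exact ⟨(smoothFields n M).zero_mem, by
            rw [VectorField.mlieBracket_zero_left]; exact Submodule.zero_mem _⟩
        · rintro V V' - - ⟨h1, h2⟩ ⟨h3, h4⟩
          exact ⟨(smoothFields n M).add_mem h1 h3, by
            rw [mlieBracket_add_left h1 h3]; exact Submodule.add_mem _ h2 h4⟩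
        · rintro t V - ⟨h1, h2⟩
          exact ⟨(smoothFields n M).smul_mem t h1, by
            rw [mlieBracket_const_smul_left t h1]; exact Submodule.smul_mem _ t h2⟩
      rw [mlieBracket_add_left hAs hBs.1]
      exact Submodule.add_mem _ (S.flag_mono (by omega) (ih hA hW)) hBs.2

/-- By `mlieBracket_mem_flag` the union of the flag is closed under brackets, so it contains the Lie
hull; at a point the chain of subspaces is stationary by finite dimension. -/
theorem exists_flagAt_eq_top (hX : S.IsGeneratingFamily X) (hS : S.BracketGenerating) (p : M) :
    ∃ r, S.flagAt r p = ⊤ := by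
  have hle : S.lieHull ≤ ⨆ i, S.flag i := by
    refine sInf_le ⟨le_iSup S.flag 1, fun V hV W hW => ?_⟩
    obtain ⟨i, hi⟩ := (Submodule.mem_iSup_of_directed _ S.flag_mono.directed_le).1 hV
    obtain ⟨j, hj⟩ := (Submodule.mem_iSup_of_directed _ S.flag_mono.directed_le).1 hW
    exact le_iSup S.flag (i + j) (hX.mlieBracket_mem_flag hi hj)
  have htop : ⨆ i, S.flagAt i p = ⊤ := by
    rw [eq_top_iff, ← hS p]
    refine (Submodule.map_mono hle).trans ?_
    rw [Submodule.map_iSup]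
    exact le_rfl
  have : FiniteDimensional ℝ (TangentSpace (𝓡 n) p) :=
    inferInstanceAs (FiniteDimensional ℝ (EuclideanSpace ℝ (Fin n)))
  obtain ⟨r, hr⟩ := WellFoundedGT.monotone_chain_condition
    (⟨fun i => S.flagAt i p, S.flagAt_mono p⟩ : ℕ →o Submodule ℝ (TangentSpace (𝓡 n) p))
  refine ⟨r, ?_⟩
  rw [eq_top_iff, ← htop]
  refine iSup_le fun i => ?_
  rcases le_total i r with h | h
  · exact S.flagAt_mono p h
  · exact (hr i h).ge

theorem flagAt_step (hX : S.IsGeneratingFamily X) (hS : S.BracketGenerating) (p : M) :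
    S.flagAt (S.step p) p = ⊤ :=
  Nat.sInf_mem (hX.exists_flagAt_eq_top hS p)

theorem flagAt_one (hX : S.IsGeneratingFamily X) (p : M) :
    S.flagAt 1 p = Submodule.span ℝ (Set.range fun a => X a p) := by
  rw [hX.flagAt_eq_span]
  congr 1
  ext v
  constructor
  · rintro ⟨I, hI, hIl, rfl⟩
    match I, hI, hIl with
    | [a], _, _ => exact ⟨a, rfl⟩
  · rintro ⟨a, rfl⟩
    exact ⟨[a], by simp, by simp, rfl⟩

theorem apply_mem_fiber {V : VField n M} (hV : V ∈ S.horizontal) (p : M) : V p ∈ S.fiber p := by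
  obtain ⟨σ, rfl⟩ := hV
  exact ⟨σ p, rfl⟩

variable [FiniteDimensional ℝ F]

/-- The values of a generating family span the fibre of the distribution. -/
theorem fiber_eq_span (hX : S.IsGeneratingFamily X) (p : M) :
    S.fiber p = Submodule.span ℝ (Set.range fun a => X a p) := by
  apply le_antisymm
  · intro v hv
    by_contra hvs
    have hU : FiniteDimensional ℝ (U p) := VectorBundle.finiteDimensional ℝ F U p
    -- Outside the span the right-hand side is `sInf ∅ = 0`, so `v` would have length zero in the
    -- metric and hence vanish, which puts it in the span after all.
    have h1 := hX.metric_eq p v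
    have h2 : {t : ℝ | ∃ u : Fin m → ℝ, v = ∑ a, u a • X a p ∧ t = ∑ a, u a ^ 2} = ∅ := by
      rw [Set.eq_empty_iff_forall_notMem]
      rintro t ⟨u, hu, -⟩
      exact hvs (hu ▸ Submodule.sum_mem _ fun a _ =>
        Submodule.smul_mem _ _ (Submodule.subset_span ⟨a, rfl⟩))
    rw [h2, Real.sInf_empty, metric, ← inducedForm_self (S.f p) ⟨v, hv⟩] at h1
    have h3 : orthSection (S.f p) ⟨v, hv⟩ = 0 := inner_self_eq_zero.1 h1
    have h4 := apply_orthSection (S.f p) ⟨v, hv⟩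
    rw [h3, map_zero] at h4
    change 0 = v at h4
    exact hvs (h4 ▸ Submodule.zero_mem _)
  · rw [Submodule.span_le]
    rintro _ ⟨a, rfl⟩
    exact apply_mem_fiber (hX.mem_horizontal a) p

theorem fiber_eq_flagAt_one (hX : S.IsGeneratingFamily X) (p : M) : S.fiber p = S.flagAt 1 p := by
  rw [hX.fiber_eq_span, hX.flagAt_one]

/-- A generating family is a Parseval frame of the fibre. -/
theorem isParseval (hX : S.IsGeneratingFamily X) (p : M) :
    IsParseval (S.metricForm p)
      (fun a => (⟨X a p, apply_mem_fiber (hX.mem_horizontal a) p⟩ : S.fiber p)) := by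
  have hU : FiniteDimensional ℝ (U p) := VectorBundle.finiteDimensional ℝ F U p
  refine isParseval_of_isLeast (fun v w => real_inner_comm _ _) fun v => ?_
  have hv : (v : TangentSpace (𝓡 n) p) ∈ Submodule.span ℝ (Set.range fun a => X a p) := by
    rw [← hX.fiber_eq_span]; exact v.2
  obtain ⟨t, ht⟩ := exists_isLeast_coeffSq (fun a => X a p) hv
  have h1 : coeffSq (fun a => (⟨X a p, apply_mem_fiber (hX.mem_horizontal a) p⟩ : S.fiber p)) v
      = coeffSq (fun a => X a p) (v : TangentSpace (𝓡 n) p) := by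
    ext t
    refine exists_congr fun u => and_congr_left fun _ => ?_
    rw [← Subtype.coe_inj]
    simp
  have h2 : S.metricForm p v v = S.metric p v := inducedForm_self (S.f p) v
  rw [h1, h2, hX.metric_eq]
  exact (ht.csInf_eq : sInf {t | _} = t) ▸ ht

end SubRiemannianStructure.IsGeneratingFamily

end Flag

theorem linearIndependent_finCons_basis {V : Type*} [AddCommGroup V] [Module ℝ V] {k : ℕ}
    {E : Submodule ℝ V} (b : Module.Basis (Fin k) ℝ E) {u : V} (hu : u ∉ E) :
    LinearIndependent ℝ (Fin.cons u fun j => (b j : V) : Fin (k + 1) → V) := by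
  refine linearIndependent_finCons.2 ⟨b.linearIndependent.map' E.subtype
    (Submodule.ker_subtype _), fun h => hu (Submodule.span_le.2 ?_ h)⟩
  rintro _ ⟨j, rfl⟩
  exact (b j).2

/-! ### Vector fields in the preferred chart. -/

section Chart

variable {n : ℕ} {M : Type*} [TopologicalSpace M] [ChartedSpace (EuclideanSpace ℝ (Fin n)) M]

theorem tendsto_symm_extChartAt (p : M) :
    Filter.Tendsto (extChartAt (𝓡 n) p).symm (𝓝 (extChartAt (𝓡 n) p p)) (𝓝 p) := by
  have := continuousAt_extChartAt_symm (I := 𝓡 n) p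
  rwa [ContinuousAt, extChartAt_to_inv] at this

variable [IsManifold (𝓡 n) ∞ M] {V : VField n M}

/-- The coordinate expression of a vector field in the preferred chart at `p`. -/
noncomputable def chartRead (p : M) (V : VField n M) :
    EuclideanSpace ℝ (Fin n) → EuclideanSpace ℝ (Fin n) :=
  VectorField.mpullbackWithin 𝓘(ℝ, EuclideanSpace ℝ (Fin n)) (𝓡 n) (extChartAt (𝓡 n) p).symm V
    (Set.range (𝓡 n))

theorem exists_linearEquiv_chartRead {p : M} {y : EuclideanSpace ℝ (Fin n)}
    (hy : y ∈ (extChartAt (𝓡 n) p).target) :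
    ∃ L : EuclideanSpace ℝ (Fin n) ≃ₗ[ℝ] TangentSpace (𝓡 n) ((extChartAt (𝓡 n) p).symm y),
      (∀ u, L u = mfderiv (𝓡 n) (𝓡 n) (extChartAt (𝓡 n) p).symm y u) ∧
      ∀ V : VField n M, L (chartRead p V y) = V ((extChartAt (𝓡 n) p).symm y) := by
  obtain ⟨L, hL⟩ := isInvertible_mfderivWithin_extChartAt_symm (I := 𝓡 n) hy
  refine ⟨L.toLinearEquiv, fun u => ?_, fun V => ?_⟩
  · have h1 : Set.range (𝓡 n) = Set.univ := (𝓡 n).range_eq_univ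
    rw [← mfderivWithin_univ, ← h1, ← hL]
    rfl
  · change L ((mfderivWithin 𝓘(ℝ, EuclideanSpace ℝ (Fin n)) (𝓡 n) (extChartAt (𝓡 n) p).symm
      (Set.range (𝓡 n)) y).inverse (V ((extChartAt (𝓡 n) p).symm y))) = _
    rw [← hL, ContinuousLinearMap.inverse_equiv]
    exact L.apply_symm_apply _

/-- The derivative of the preferred chart at its own centre is the identity of the model space, so
no change of frame appears there. The coordinate formula for the bracket at `p` uses the same fact.
-/
theorem chartRead_self (p : M) (V : VField n M) : chartRead p V (extChartAt (𝓡 n) p p) = V p := by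
  have h := mfderivWithin_extChartAt_symm_inverse_apply (I := 𝓡 n) (x := p) (V p)
  change (mfderivWithin 𝓘(ℝ, EuclideanSpace ℝ (Fin n)) (𝓡 n) (extChartAt (𝓡 n) p).symm
      (Set.range (𝓡 n)) (extChartAt (𝓡 n) p p)).inverse
        (V ((extChartAt (𝓡 n) p).symm (extChartAt (𝓡 n) p p))) = _
  have h2 : (V ((extChartAt (𝓡 n) p).symm (extChartAt (𝓡 n) p p)) : EuclideanSpace ℝ (Fin n))
      = V p := by rw [extChartAt_to_inv]
  exact (congrArg _ h2).trans h

theorem differentiableAt_chartRead (hV : V.Smooth) (p : M) :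
    DifferentiableAt ℝ (chartRead p V) (extChartAt (𝓡 n) p p) := by
  have h : DifferentiableWithinAt ℝ (chartRead p V)
      ((extChartAt (𝓡 n) p).symm ⁻¹' Set.univ ∩ Set.range (𝓡 n)) (extChartAt (𝓡 n) p p) :=
    MDifferentiableWithinAt.differentiableWithinAt_mpullbackWithin_vectorField
      (hV.mdifferentiableAt p).mdifferentiableWithinAt
  rw [Set.preimage_univ, Set.univ_inter, (𝓡 n).range_eq_univ] at h
  exact differentiableWithinAt_univ.1 h

theorem mlieBracket_eq_chartRead (V W : VField n M) (p : M) :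
    (VectorField.mlieBracket (𝓡 n) V W p : EuclideanSpace ℝ (Fin n)) =
      fderiv ℝ (chartRead p W) (extChartAt (𝓡 n) p p) (V p)
        - fderiv ℝ (chartRead p V) (extChartAt (𝓡 n) p p) (W p) := by
  have h1 : ∀ v : TangentSpace (𝓡 n) p,
      (mfderiv (𝓡 n) 𝓘(ℝ, EuclideanSpace ℝ (Fin n)) (extChartAt (𝓡 n) p) p).inverse v = v :=
    fun v => (congrArg _ (mfderivWithin_extChartAt_symm_inverse_apply (I := 𝓡 n) (x := p) v).symm).trans
      (VectorField.mfderiv_extChartAt_inverse_comp_mfderivWithin_extChartAT_symm v)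
  have h2 : VectorField.lieBracketWithin ℝ (chartRead p V) (chartRead p W)
      ((extChartAt (𝓡 n) p).symm ⁻¹' Set.univ ∩ Set.range (𝓡 n)) (extChartAt (𝓡 n) p p)
      = fderiv ℝ (chartRead p W) (extChartAt (𝓡 n) p p) (chartRead p V (extChartAt (𝓡 n) p p))
        - fderiv ℝ (chartRead p V) (extChartAt (𝓡 n) p p)
          (chartRead p W (extChartAt (𝓡 n) p p)) := by
    rw [Set.preimage_univ, Set.univ_inter, (𝓡 n).range_eq_univ, VectorField.lieBracketWithin_univ]
    rfl
  rw [chartRead_self, chartRead_self] at h2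
  exact (h1 _).trans h2

end Chart

/-! ### Consequences of constant rank at regular points. -/

section Regular

variable {n : ℕ} {M : Type*} [TopologicalSpace M] [ChartedSpace (EuclideanSpace ℝ (Fin n)) M]
  [IsManifold (𝓡 n) ∞ M]
  {F : Type*} [NormedAddCommGroup F] [NormedSpace ℝ F]
  {U : M → Type*} [TopologicalSpace (TotalSpace F U)]
  [∀ x, NormedAddCommGroup (U x)] [∀ x, InnerProductSpace ℝ (U x)]
  [FiberBundle F U] [VectorBundle ℝ F U]
  {S : SubRiemannianStructure n F U} {m : ℕ} {X : Fin m → VField n M}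

instance (p : M) : FiniteDimensional ℝ (TangentSpace (𝓡 n) p) :=
  inferInstanceAs (FiniteDimensional ℝ (EuclideanSpace ℝ (Fin n)))

namespace SubRiemannianStructure.IsGeneratingFamily

/-- The derivative of a field of `𝒟ⁱ` at a zero which is a regular point takes values in
`𝒟ⁱ`. -/
theorem fderiv_chartRead_mem (hX : S.IsGeneratingFamily X) {p : M} (hp : p ∈ S.regularSet) {i : ℕ}
    {Y : VField n M} (hY : Y ∈ S.flag i) (hYp : Y p = 0) (w : EuclideanSpace ℝ (Fin n)) :
    (fderiv ℝ (chartRead p Y) (extChartAt (𝓡 n) p p) w : TangentSpace (𝓡 n) p)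
      ∈ S.flagAt i p := by
  by_contra hu
  set y₀ := extChartAt (𝓡 n) p p with hy₀
  set u := fderiv ℝ (chartRead p Y) y₀ w with hu_def
  let b := Module.finBasis ℝ (S.flagAt i p)
  have hb : ∀ j, ∃ Z ∈ S.flag i, Z p = b j := fun j => (b j).2
  choose Z hZ hZp using hb
  -- For `t ≠ 0` these are coordinates of vectors of `𝒟ⁱ` at a nearby point: a difference quotient
  -- of `Y` at its zero, and fields extending a basis of `𝒟ⁱ_p`. If `u` were outside `𝒟ⁱ_p`, the
  -- limit family would be independent, hence so would the nearby ones, and the rank of `𝒟ⁱ` would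
  -- jump.
  let f : ℝ → Fin (Module.finrank ℝ (S.flagAt i p) + 1) → EuclideanSpace ℝ (Fin n) := fun t =>
    Fin.cons (t⁻¹ • chartRead p Y (y₀ + t • w)) fun j => chartRead p (Z j) (y₀ + t • w)
  have hline : Filter.Tendsto (fun t : ℝ => y₀ + t • w) (𝓝[≠] 0) (𝓝 y₀) := by
    have : Continuous fun t : ℝ => y₀ + t • w := by fun_prop
    have h := this.tendsto 0
    rw [zero_smul, add_zero] at h
    exact h.mono_left nhdsWithin_le_nhds
  have hlim : Filter.Tendsto f (𝓝[≠] 0) (𝓝 (Fin.cons u fun j => (b j : TangentSpace (𝓡 n) p))) := by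
    rw [tendsto_pi_nhds]
    intro j
    refine Fin.cases ?_ (fun j => ?_) j
    · simp only [f, Fin.cons_zero]
      have h1 : HasDerivAt (fun t : ℝ => chartRead p Y (y₀ + t • w)) u 0 := by
        have h2 : HasDerivAt (fun t : ℝ => y₀ + t • w) w 0 := by
          simpa using ((hasDerivAt_id (0 : ℝ)).smul_const w).const_add y₀
        have h3 := (differentiableAt_chartRead (hX.flag_le_smoothFields i hY) p).hasFDerivAt
        rw [← hy₀] at h3
        have h4 : HasFDerivAt (chartRead p Y) (fderiv ℝ (chartRead p Y) y₀) (y₀ + (0 : ℝ) • w) := by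
          rwa [zero_smul, add_zero]
        exact h4.comp_hasDerivAt (0 : ℝ) h2
      rw [hasDerivAt_iff_tendsto_slope] at h1
      refine h1.congr fun t => ?_
      have h0 : chartRead p Y y₀ = 0 := (chartRead_self p Y).trans hYp
      simp [slope, h0]
    · simp only [f, Fin.cons_succ]
      have h1 := (differentiableAt_chartRead (hX.flag_le_smoothFields i (hZ j)) p).continuousAt
      rw [ContinuousAt, chartRead_self, hZp] at h1
      exact Filter.Tendsto.comp h1 hline
  have hli : LinearIndependent ℝ (M := EuclideanSpace ℝ (Fin n))
      (Fin.cons u fun j => (b j : TangentSpace (𝓡 n) p)) :=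
    linearIndependent_finCons_basis (V := TangentSpace (𝓡 n) p) b hu
  have h1 := hlim.eventually hli.eventually
  have h2 := hline.eventually ((isOpen_extChartAt_target (I := 𝓡 n) p).mem_nhds
    (mem_extChartAt_target (I := 𝓡 n) p))
  have h3 := hline.eventually ((tendsto_symm_extChartAt p).eventually hp)
  obtain ⟨t, ht1, ht2, ht3⟩ := (h1.and (h2.and h3)).exists
  obtain ⟨L, -, hL⟩ := exists_linearEquiv_chartRead ht2
  have h4 : LinearIndependent ℝ (fun j => L (f t j)) :=
    (LinearMap.linearIndependent_iff L.toLinearMap L.ker).2 ht1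
  have h5 := card_le_finrank_of_linearIndependent h4
    (S.flagAt i ((extChartAt (𝓡 n) p).symm (y₀ + t • w))) Finset.univ fun j _ => by
      refine Fin.cases ?_ (fun j => ?_) j
      · simp only [f, Fin.cons_zero, map_smul, hL]
        exact Submodule.smul_mem _ _ (apply_mem_flagAt hY _)
      · simp only [f, Fin.cons_succ, hL]
        exact apply_mem_flagAt (hZ j) _
  have h6 := ht3 i
  rw [growth, growth] at h6
  rw [Finset.card_univ, Fintype.card_fin, h6] at h5
  omega

/-- At a zero of `Y` the bracket is the derivative of `Y` in the direction `V p`, so bracketing with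
an arbitrary `V` does not raise the degree. -/
theorem mlieBracket_mem_flagAt_of_right_eq_zero (hX : S.IsGeneratingFamily X) {p : M}
    (hp : p ∈ S.regularSet) {i : ℕ} {V Y : VField n M} (hY : Y ∈ S.flag i) (hYp : Y p = 0) :
    VectorField.mlieBracket (𝓡 n) V Y p ∈ S.flagAt i p := by
  have h := hX.fderiv_chartRead_mem hp hY hYp (V p)
  have h2 := mlieBracket_eq_chartRead V Y p
  rw [hYp] at h2
  erw [map_zero, sub_zero] at h2
  exact h2 ▸ h

theorem mlieBracket_mem_flagAt_of_left_eq_zero (hX : S.IsGeneratingFamily X) {p : M}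
    (hp : p ∈ S.regularSet) {i : ℕ} {V Y : VField n M} (hY : Y ∈ S.flag i) (hYp : Y p = 0) :
    VectorField.mlieBracket (𝓡 n) Y V p ∈ S.flagAt i p := by
  rw [VectorField.mlieBracket_swap_apply]
  exact Submodule.neg_mem _ (hX.mlieBracket_mem_flagAt_of_right_eq_zero hp hY hYp)

/-- `Y` is compared with a field of `𝒟ⁱ` having the same value at `p`; the difference vanishes at
`p`, so the previous case applies to it. -/
theorem mlieBracket_mem_flagAt_succ (hX : S.IsGeneratingFamily X) {p : M}
    (hp : p ∈ S.regularSet) {i : ℕ} {V Y : VField n M} (hV : V ∈ S.horizontal)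
    (hY : Y ∈ S.flag (i + 1)) (hYp : Y p ∈ S.flagAt i p) :
    VectorField.mlieBracket (𝓡 n) V Y p ∈ S.flagAt (i + 1) p := by
  obtain ⟨Z, hZ, hZp⟩ := hYp
  have hZ' : Z ∈ S.flag (i + 1) := S.flag_mono (Nat.le_succ _) hZ
  have hsub : Y - Z ∈ S.flag (i + 1) := Submodule.sub_mem _ hY hZ'
  have h1 := hX.mlieBracket_mem_flagAt_of_right_eq_zero hp (V := V) hsub (by
    change Y p - Z p = 0
    rw [sub_eq_zero]; exact hZp.symm)
  have h2 := apply_mem_flagAt (mlieBracket_mem_flag_succ hV hZ) p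
  have h3 := mlieBracket_add_right (Z := V) (hX.flag_le_smoothFields _ hsub)
    (hX.flag_le_smoothFields _ hZ')
  rw [sub_add_cancel] at h3
  rw [h3]
  exact Submodule.add_mem _ h1 h2

/-- At a regular point a flag that stalls once stalls forever, since the bracket modulo lower order
sees only the value of `Y` at `p`. This makes the growth strict below the step. -/
theorem flagAt_succ_eq (hX : S.IsGeneratingFamily X) {p : M}
    (hp : p ∈ S.regularSet) {i : ℕ} (h : S.flagAt (i + 1) p = S.flagAt i p) :
    S.flagAt (i + 2) p = S.flagAt (i + 1) p := by
  refine le_antisymm ?_ (S.flagAt_mono p (Nat.le_succ _))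
  rw [flagAt, flag, Submodule.map_sup, Submodule.map_span]
  refine sup_le le_rfl (Submodule.span_le.2 ?_)
  rintro _ ⟨_, ⟨V, hV, Y, hY, rfl⟩, rfl⟩
  exact hX.mlieBracket_mem_flagAt_succ hp hV hY (h ▸ apply_mem_flagAt hY p)

theorem growth_lt_growth_succ (hX : S.IsGeneratingFamily X) (hS : S.BracketGenerating) {p : M}
    (hp : p ∈ S.regularSet) {i : ℕ} (hi : i < S.step p) : S.growth i p < S.growth (i + 1) p := by
  refine Submodule.finrank_lt_finrank_of_lt (lt_of_le_of_ne (S.flagAt_mono p (Nat.le_succ i)) ?_)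
  intro h
  have h1 : ∀ j, S.flagAt (i + j + 1) p = S.flagAt (i + j) p := fun j => by
    induction j with
    | zero => exact h.symm
    | succ j ih => exact hX.flagAt_succ_eq hp ih
  have h2 : ∀ j, S.flagAt (i + j) p = S.flagAt i p := fun j => by
    induction j with
    | zero => rfl
    | succ j ih => rw [← add_assoc, h1, ih]
  have h3 := h2 (S.step p - i)
  rw [Nat.add_sub_cancel' hi.le, hX.flagAt_step hS] at h3
  exact absurd (Nat.sInf_le (show i ∈ {r | S.flagAt r p = ⊤} from h3.symm)) (not_le.2 hi)

/-- At a regular point the step is at most the dimension. -/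
theorem step_le (hX : S.IsGeneratingFamily X) (hS : S.BracketGenerating) {p : M}
    (hp : p ∈ S.regularSet) : S.step p ≤ n := by
  have h1 : ∀ i ≤ S.step p, i ≤ S.growth i p := fun i => by
    induction i with
    | zero => intro _; exact Nat.zero_le _
    | succ i ih =>
      intro hi
      have := hX.growth_lt_growth_succ hS hp (Nat.lt_of_succ_le hi)
      have := ih (Nat.le_of_succ_le hi)
      omega
  have h2 : S.growth (S.step p) p ≤ n := by
    have := Submodule.finrank_le (S.flagAt (S.step p) p)
    have h3 : Module.finrank ℝ (TangentSpace (𝓡 n) p) = n := finrank_euclideanSpace_fin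
    rwa [h3] at this
  exact (h1 _ le_rfl).trans h2

/-- Induction through `[V₀, T] - [V₀', T'] = [V₀ - V₀', T] + [V₀', T - T']`. The first term is a
bracket with a horizontal field vanishing at `p`, hence lies in `𝒟¹_p`; in the second, `T - T'` has
a value of lower degree by induction. -/
theorem iteratedBracket_ofFn_sub_mem (hX : S.IsGeneratingFamily X) {p : M}
    (hp : p ∈ S.regularSet) (i : ℕ) {V V' : Fin (i + 1) → VField n M}
    (hV : ∀ j, V j ∈ S.horizontal) (hV' : ∀ j, V' j ∈ S.horizontal) (h : ∀ j, V j p = V' j p) :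
    iteratedBracket (List.ofFn V) p - iteratedBracket (List.ofFn V') p ∈ S.flagAt i p := by
  have hmem : ∀ (i : ℕ) (V : Fin (i + 1) → VField n M), (∀ j, V j ∈ S.horizontal) →
      iteratedBracket (List.ofFn V) ∈ S.flag (i + 1) := fun i V hV => by
    have := SubRiemannianStructure.iteratedBracket_mem_flag (S := S) (List.ofFn V) fun W hW => by
      obtain ⟨j, rfl⟩ := List.mem_ofFn.1 hW
      exact hV j
    rwa [List.length_ofFn] at this
  induction i with
  | zero =>
    have : iteratedBracket (List.ofFn V) p - iteratedBracket (List.ofFn V') p = 0 := by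
      rw [sub_eq_zero]; exact h 0
    rw [this]
    exact Submodule.zero_mem _
  | succ i ih =>
    have hT := hmem i (fun j => V j.succ) fun j => hV _
    have hT' := hmem i (fun j => V' j.succ) fun j => hV' _
    have ih := ih (fun j => hV j.succ) (fun j => hV' j.succ) fun j => h j.succ
    have hcons : ∀ V : Fin (i + 2) → VField n M, iteratedBracket (List.ofFn V)
        = VectorField.mlieBracket (𝓡 n) (V 0) (iteratedBracket (List.ofFn fun j => V j.succ)) :=
      fun V => by rw [List.ofFn_succ, List.ofFn_succ]; rfl
    rw [hcons V, hcons V']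
    set T := iteratedBracket (List.ofFn fun j => V j.succ)
    set T' := iteratedBracket (List.ofFn fun j => V' j.succ)
    have hTs := hX.flag_le_smoothFields _ hT
    have hTs' := hX.flag_le_smoothFields _ hT'
    have hV0 := hX.horizontal_le_smoothFields (hV 0)
    have hV0' := hX.horizontal_le_smoothFields (hV' 0)
    have h1 := hX.mlieBracket_mem_flagAt_of_left_eq_zero (i := 1) hp (V := T)
      (Y := V 0 - V' 0) (Submodule.sub_mem _ (hV 0) (hV' 0)) (sub_eq_zero.2 (h 0))
    have h2 := hX.mlieBracket_mem_flagAt_succ hp (hV' 0) (Submodule.sub_mem _ hT hT') ih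
    have h3 := mlieBracket_add_left (Z := T) ((smoothFields n M).sub_mem hV0 hV0') hV0'
    have h4 := mlieBracket_add_right (Z := V' 0) ((smoothFields n M).sub_mem hTs hTs') hTs'
    rw [sub_add_cancel] at h3 h4
    rw [h3]
    have h5 : (VectorField.mlieBracket (𝓡 n) (V 0 - V' 0) T
        + VectorField.mlieBracket (𝓡 n) (V' 0) T) p - VectorField.mlieBracket (𝓡 n) (V' 0) T' p
        = VectorField.mlieBracket (𝓡 n) (V 0 - V' 0) T p
          + VectorField.mlieBracket (𝓡 n) (V' 0) (T - T') p := by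
      rw [h4]
      simp only [Pi.add_apply]
      abel
    rw [h5]
    exact Submodule.add_mem _ (S.flagAt_mono p (Nat.le_add_left 1 i) h1) h2

/-- At a regular point the iterated brackets are well defined on the tensor powers of the
distribution. -/
theorem isBracketMap_bracketMap [FiniteDimensional ℝ F] (hX : S.IsGeneratingFamily X) {p : M}
    (hp : p ∈ S.regularSet) (i : ℕ) : S.IsBracketMap p i (S.bracketMap p i) := by
  suffices h : ∃ φ, S.IsBracketMap p i φ by
    rw [bracketMap, dif_pos h]
    exact h.choose_spec
  let ev : S.horizontal →ₗ[ℝ] S.fiber p :=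
    ((LinearMap.proj p : VField n M →ₗ[ℝ] TangentSpace (𝓡 n) p) ∘ₗ
      S.horizontal.subtype).codRestrict _ fun V => apply_mem_fiber V.2 p
  have hev : LinearMap.range ev = ⊤ := by
    rw [LinearMap.range_eq_top]
    rintro ⟨v, hv⟩
    have hv' := hv
    rw [hX.fiber_eq_flagAt_one] at hv'
    obtain ⟨V, hV, rfl⟩ := hv'
    exact ⟨⟨V, hV⟩, rfl⟩
  -- A linear choice of horizontal extensions makes the bracket multilinear in the values at `p`;
  -- `iteratedBracket_ofFn_sub_mem` shows that other extensions give the same class.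
  obtain ⟨s, hs⟩ := ev.exists_rightInverse_of_surjective hev
  let ψ : MultilinearMap ℝ (fun _ : Fin (i + 1) => S.fiber p)
      (TangentSpace (𝓡 n) p ⧸ S.flagAt i p) :=
    (((S.flagAt i p).mkQ ∘ₗ (LinearMap.proj p : VField n M →ₗ[ℝ] TangentSpace (𝓡 n) p) ∘ₗ
      (smoothFields n M).subtype).compMultilinearMap (iteratedBracketₗ i)).compLinearMap
        fun _ => (Submodule.inclusion hX.horizontal_le_smoothFields) ∘ₗ s
  refine ⟨PiTensorProduct.lift ψ, fun v V hV hVv => ?_⟩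
  rw [PiTensorProduct.lift.tprod]
  have h1 : ψ v = (S.flagAt i p).mkQ
      (iteratedBracket (List.ofFn fun j => (s (v j) : VField n M)) p) := by
    have := coe_iteratedBracketₗ i fun j =>
      Submodule.inclusion hX.horizontal_le_smoothFields (s (v j))
    exact congrArg (fun W : VField n M => (S.flagAt i p).mkQ (W p)) this
  rw [h1, ← sub_eq_zero, ← map_sub, ← LinearMap.mem_ker, Submodule.ker_mkQ]
  refine hX.iteratedBracket_ofFn_sub_mem hp i (fun j => (s (v j)).2) hV fun j => ?_
  rw [hVv]
  exact congrArg Subtype.val (LinearMap.congr_fun hs (v j))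

end SubRiemannianStructure.IsGeneratingFamily

end Regular

/-- Words of length between `1` and `r` in `m` letters. -/
abbrev Word (m r : ℕ) : Type := Σ i : Fin r, (Fin (i + 1) → Fin m)

/-! ### The graded space, its splittings and its norm. -/

section Graded

variable {n : ℕ} {M : Type*} [TopologicalSpace M] [ChartedSpace (EuclideanSpace ℝ (Fin n)) M]
  [IsManifold (𝓡 n) ∞ M]
  {F : Type*} [NormedAddCommGroup F] [NormedSpace ℝ F]
  {U : M → Type*} [TopologicalSpace (TotalSpace F U)]
  [∀ x, NormedAddCommGroup (U x)] [∀ x, InnerProductSpace ℝ (U x)]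
  [FiberBundle F U] [VectorBundle ℝ F U]
  {S : SubRiemannianStructure n F U} {m : ℕ} {X : Fin m → VField n M}

/-- The iterated bracket of the fields `X a` along a word. -/
noncomputable def wordField (X : Fin m → VField n M) {r : ℕ} (w : Word m r) : VField n M :=
  iteratedBracket ((List.ofFn w.2).map X)

/-- The sum of the squares of the values of `Ω` on the `n`-tuples of brackets of lengths at most
`r` with total length `d`. -/
noncomputable def frameSum (X : Fin m → VField n M) (Ω : TopForm n M) (r : ℕ) (d : ℤ) (p : M) : ℝ :=
  ∑ I : Fin n → Word m r, if ((∑ k, ((I k).1 + 1 : ℕ) : ℕ) : ℤ) = d then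
    Ω p (fun k => wordField X (I k) p) ^ 2 else 0

namespace SubRiemannianStructure

section Splitting

variable {p : M} {L : S.Gr p →ₗ[ℝ] TangentSpace (𝓡 n) p}

theorem splitting_single_mem
    (hL : ∀ (i : Fin (S.step p)) (w : S.grPiece p i), (S.flagAt i p).mkQ (L (Pi.single i w)) = w)
    (i : Fin (S.step p)) (w : S.grPiece p i) : L (Pi.single i w) ∈ S.flagAt (i + 1) p := by
  obtain ⟨v, hv, hvw⟩ := w.2
  have h := hL i w
  rw [← hvw, ← sub_eq_zero, ← map_sub, ← LinearMap.mem_ker, Submodule.ker_mkQ] at h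
  have := Submodule.add_mem _ (S.flagAt_mono p (Nat.le_succ i) h) hv
  simpa using this

/-- Triangularity: subtracting the lift of the leading class of `v` lowers its degree by one. -/
theorem exists_splitting_eq
    (hL : ∀ (i : Fin (S.step p)) (w : S.grPiece p i), (S.flagAt i p).mkQ (L (Pi.single i w)) = w)
    {i : ℕ} (hi : i ≤ S.step p) : ∀ v ∈ S.flagAt i p,
      ∃ w : S.Gr p, L w = v ∧ ∀ j : Fin (S.step p), i ≤ j → w j = 0 := by
  induction i with
  | zero =>
    intro v hv
    rw [flagAt_zero, Submodule.mem_bot] at hv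
    exact ⟨0, by simp [hv], fun _ _ => rfl⟩
  | succ i ih =>
    intro v hv
    let j : Fin (S.step p) := ⟨i, hi⟩
    let x : S.grPiece p j := ⟨(S.flagAt i p).mkQ v, v, hv, rfl⟩
    have h1 : v - L (Pi.single j x) ∈ S.flagAt i p := by
      rw [← Submodule.ker_mkQ (S.flagAt i p), LinearMap.mem_ker, map_sub, sub_eq_zero]
      exact (hL j x).symm
    obtain ⟨w, hw, hw0⟩ := ih (Nat.le_of_succ_le hi) _ h1
    refine ⟨w + Pi.single j x, by rw [map_add, hw]; simp, fun k hk => ?_⟩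
    have hkj : k ≠ j := fun h => by
      have : (k : ℕ) = i := congrArg Fin.val h
      omega
    rw [Pi.add_apply, hw0 k (by omega), Pi.single_eq_of_ne hkj, add_zero]

/-- The topmost nonzero component `w i` can be read off from `L w` modulo `𝒟ⁱ_p`, where the lower
components die. -/
theorem splitting_injective
    (hL : ∀ (i : Fin (S.step p)) (w : S.grPiece p i), (S.flagAt i p).mkQ (L (Pi.single i w)) = w) :
    Function.Injective L := by
  classical
  rw [← LinearMap.ker_eq_bot, LinearMap.ker_eq_bot']
  intro w hw
  by_contra hne
  obtain ⟨i, hi, hmax⟩ : ∃ i, w i ≠ 0 ∧ ∀ j, i < j → w j = 0 := by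
    have hs : (Finset.univ.filter fun i => w i ≠ 0).Nonempty := by
      by_contra h
      rw [Finset.not_nonempty_iff_eq_empty, Finset.filter_eq_empty_iff] at h
      exact hne (funext fun i => not_not.1 (h (Finset.mem_univ i)))
    refine ⟨_, (Finset.mem_filter.1 (Finset.max'_mem _ hs)).2, fun j hj => ?_⟩
    by_contra h
    exact absurd (Finset.le_max' _ j (Finset.mem_filter.2 ⟨Finset.mem_univ _, h⟩)) (not_le.2 hj)
  have h1 : (S.flagAt i p).mkQ (L w) = w i := by
    conv_lhs => rw [← Finset.univ_sum_single w]
    rw [map_sum, map_sum, Finset.sum_eq_single i, hL]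
    · intro j _ hj
      rcases lt_or_gt_of_ne hj with h | h
      · rw [← LinearMap.mem_ker, Submodule.ker_mkQ]
        exact S.flagAt_mono p (Nat.succ_le_of_lt h) (splitting_single_mem hL j _)
      · rw [hmax j h, Pi.single_zero, map_zero, map_zero]
    · simp
  rw [hw, map_zero] at h1
  exact hi (Subtype.ext h1.symm)

theorem exists_isSplitting (h : S.flagAt (S.step p) p = ⊤) :
    ∃ L : S.Gr p ≃ₗ[ℝ] TangentSpace (𝓡 n) p, S.IsSplitting p L := by
  have hs : ∀ i : ℕ, ∃ s : (TangentSpace (𝓡 n) p ⧸ S.flagAt i p) →ₗ[ℝ] TangentSpace (𝓡 n) p,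
      (S.flagAt i p).mkQ ∘ₗ s = LinearMap.id := fun i =>
    (S.flagAt i p).mkQ.exists_rightInverse_of_surjective (Submodule.range_mkQ _)
  choose s hs using hs
  let L : S.Gr p →ₗ[ℝ] TangentSpace (𝓡 n) p :=
    ∑ i : Fin (S.step p), s i ∘ₗ (S.grPiece p i).subtype ∘ₗ LinearMap.proj i
  have hL : ∀ (i : Fin (S.step p)) (w : S.grPiece p i),
      (S.flagAt i p).mkQ (L (Pi.single i w)) = w := by
    intro i w
    have h1 : L (Pi.single i w) = s i w := by
      simp only [L, LinearMap.sum_apply, LinearMap.comp_apply, LinearMap.proj_apply]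
      rw [Finset.sum_eq_single i]
      · simp
      · intro j _ hj
        rw [Pi.single_eq_of_ne hj, map_zero, map_zero]
      · simp
    rw [h1]
    exact LinearMap.congr_fun (hs i) w
  refine ⟨LinearEquiv.ofBijective L ⟨splitting_injective hL, fun v => ?_⟩, hL⟩
  obtain ⟨w, hw, -⟩ := exists_splitting_eq hL le_rfl v (h ▸ Submodule.mem_top)
  exact ⟨w, hw⟩

end Splitting

namespace IsGeneratingFamily

variable {p : M}

theorem wordField_mem_flag (hX : S.IsGeneratingFamily X) {r : ℕ} (w : Word m r) :
    wordField X w ∈ S.flag (w.1 + 1) :=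
  hX.iteratedBracket_mem_flag (by simp)

/-- The class of a bracket in the graded space. -/
noncomputable def grVec (hX : S.IsGeneratingFamily X) (p : M) (i : Fin (S.step p)) (J : Fin (i + 1) → Fin m) :
    S.grPiece p i :=
  ⟨(S.flagAt i p).mkQ (wordField X (⟨i, J⟩ : Word m _) p),
    Submodule.mem_map_of_mem (apply_mem_flagAt (hX.wordField_mem_flag ⟨i, J⟩) p)⟩

/-- The class of a bracket in the graded space, extended by zero. -/
noncomputable def wordVec (hX : S.IsGeneratingFamily X) (p : M) (w : Word m (S.step p)) : S.Gr p :=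
  Pi.single w.1 (hX.grVec p w.1 w.2)

theorem grPiece_le_span (hX : S.IsGeneratingFamily X) (p : M) (i : Fin (S.step p)) :
    S.grPiece p i ≤ Submodule.span ℝ (Set.range fun J : Fin (i + 1) → Fin m =>
      (S.flagAt i p).mkQ (wordField X (⟨i, J⟩ : Word m (S.step p)) p)) := by
  rw [grPiece, hX.flagAt_eq_span (i + 1), Submodule.map_span, Submodule.span_le]
  rintro _ ⟨_, ⟨I, hI, hIl, rfl⟩, rfl⟩
  rcases hIl.lt_or_eq with h | h
  · have : (S.flagAt i p).mkQ (iteratedBracket (I.map X) p) = 0 := by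
      rw [← LinearMap.mem_ker, Submodule.ker_mkQ]
      exact apply_mem_flagAt (hX.iteratedBracket_mem_flag (Nat.le_of_lt_succ h)) p
    rw [this]
    exact Submodule.zero_mem _
  · refine Submodule.subset_span ⟨fun j => I.get (j.cast h.symm), ?_⟩
    have : List.ofFn (fun j : Fin (i + 1) => I.get (j.cast h.symm)) = I := by
      rw [← List.ofFn_congr h I.get, List.ofFn_get]
    simp only [wordField, this]

variable [FiniteDimensional ℝ F]

/-- The tensors of the `X a p` form a Parseval frame of the tensor power, and `bracketMap` sends
them to the classes of the iterated brackets; the quotient norm is therefore computed by the latter.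
-/
theorem isLeast_pieceSqNorm (hX : S.IsGeneratingFamily X) (hp : p ∈ S.regularSet)
    (i : Fin (S.step p)) (w : S.grPiece p i) :
    IsLeast (coeffSq (hX.grVec p i) w) (S.pieceSqNorm p i w) := by
  have h1 : coeffSq (hX.grVec p i) w
      = coeffSq (fun J => (hX.grVec p i J : TangentSpace (𝓡 n) p ⧸ S.flagAt i p)) w := by
    ext t
    refine exists_congr fun u => and_congr_left fun _ => ?_
    rw [← Subtype.coe_inj]
    simp
  have h2 : ∀ J : Fin (i + 1) → Fin m, S.bracketMap p i (PiTensorProduct.tprod ℝ fun j =>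
      (⟨X (J j) p, apply_mem_fiber (hX.mem_horizontal (J j)) p⟩ : S.fiber p))
        = hX.grVec p i J := fun J => by
    rw [hX.isBracketMap_bracketMap hp i _ (fun j => X (J j)) (fun j => hX.mem_horizontal _)
      fun j => rfl]
    simp only [grVec, wordField, List.map_ofFn]
    rfl
  obtain ⟨t, ht⟩ := exists_isLeast_coeffSq _ (hX.grPiece_le_span p i w.2)
  have h3 : S.pieceSqNorm p i w = t := by
    refine ((hX.isParseval p).tensor (i + 1)).sInf_eq (S.bracketMap p i) (w := w) ?_
    simp only [h2]
    exact ht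
  rw [h1, h3]
  exact ht

theorem isLeast_grSqNorm (hX : S.IsGeneratingFamily X) (hp : p ∈ S.regularSet) (w : S.Gr p) :
    IsLeast (coeffSq (hX.wordVec p) w) (S.grSqNorm p w) :=
  isLeast_coeffSq_single (fun i => hX.grVec p i) w (fun i => S.pieceSqNorm p i (w i))
    fun i => hX.isLeast_pieceSqNorm hp i (w i)

/-- Ensures that `poppForm` has its intended value on the regular set and not the default `0`. -/
theorem exists_isPoppFormAt (hX : S.IsGeneratingFamily X) (hS : S.BracketGenerating)
    (hp : p ∈ S.regularSet) : ∃ ϖ, S.IsPoppFormAt p ϖ := by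
  obtain ⟨L, hL⟩ := exists_isSplitting (hX.flagAt_step hS p)
  have hspan : Submodule.span ℝ (Set.range (hX.wordVec p)) = ⊤ := by
    rw [eq_top_iff]
    intro w _
    obtain ⟨u, hu, -⟩ := (hX.isLeast_grSqNorm hp w).1
    rw [hu]
    exact Submodule.sum_mem _ fun a _ =>
      Submodule.smul_mem _ _ (Submodule.subset_span ⟨a, rfl⟩)
  have hn : Module.finrank ℝ (S.Gr p) = n := by
    rw [L.finrank_eq]
    exact finrank_euclideanSpace_fin
  obtain ⟨b, hb⟩ := exists_basis_isLeast_coeffSq _ hspan hn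
  refine ⟨b.det.compLinearMap L.symm.toLinearMap, b, fun c =>
    (hX.isLeast_grSqNorm hp _).unique (hb c), L, hL, ?_⟩
  ext v
  simp

end IsGeneratingFamily

end SubRiemannianStructure

end Graded

/-! ### Popp's form evaluated on frames of brackets. -/

section Frames

variable {n : ℕ} {M : Type*} [TopologicalSpace M] [ChartedSpace (EuclideanSpace ℝ (Fin n)) M]
  {Ω : TopForm n M} {p : M}

theorem linearIndependent_of_apply_ne_zero {v : Fin n → TangentSpace (𝓡 n) p} (h : Ω p v ≠ 0) :
    LinearIndependent ℝ v := by
  by_contra hv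
  exact h ((Ω p).map_linearDependent v hv)

theorem span_eq_top_of_linearIndependent {v : Fin n → TangentSpace (𝓡 n) p}
    (h : LinearIndependent ℝ v) : Submodule.span ℝ (Set.range v) = ⊤ := by
  refine h.span_eq_top_of_card_eq_finrank' ?_
  rw [Fintype.card_fin]
  exact finrank_euclideanSpace_fin.symm

theorem apply_ne_zero_of_linearIndependent (hΩ : Ω p ≠ 0) {v : Fin n → TangentSpace (𝓡 n) p}
    (h : LinearIndependent ℝ v) : Ω p v ≠ 0 := by
  intro h0
  let b := Module.Basis.mk h (span_eq_top_of_linearIndependent h).ge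
  refine hΩ (b.ext_alternating fun σ hσ => ?_)
  let τ : Equiv.Perm (Fin n) := Equiv.ofBijective σ (Finite.injective_iff_bijective.1 hσ)
  have h1 : (fun i => b (σ i)) = v ∘ τ := funext fun i => by simp [b, τ]
  rw [h1, AlternatingMap.map_perm, h0]
  simp

theorem exists_eq_smul (hΩ : Ω p ≠ 0) (ϖ : (TangentSpace (𝓡 n) p) [⋀^Fin n]→ₗ[ℝ] ℝ) :
    ∃ h : ℝ, ϖ = h • Ω p := by
  have hn : Module.finrank ℝ (TangentSpace (𝓡 n) p) = n := finrank_euclideanSpace_fin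
  let b : Module.Basis (Fin n) ℝ (TangentSpace (𝓡 n) p) :=
    (Module.finBasis ℝ (TangentSpace (𝓡 n) p)).reindex (finCongr hn)
  have h1 := ϖ.eq_smul_basis_det b
  have h2 := (Ω p).eq_smul_basis_det b
  have h3 : Ω p b ≠ 0 := apply_ne_zero_of_linearIndependent hΩ b.linearIndependent
  refine ⟨ϖ b / Ω p b, h1.trans ?_⟩
  calc ϖ b • b.det = (ϖ b / Ω p b) • (Ω p b • b.det) := by
        rw [smul_smul, div_mul_cancel₀ _ h3]
    _ = _ := congrArg _ h2.symm

variable [IsManifold (𝓡 n) ∞ M]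
  {F : Type*} [NormedAddCommGroup F] [NormedSpace ℝ F]
  {U : M → Type*} [TopologicalSpace (TotalSpace F U)]
  [∀ x, NormedAddCommGroup (U x)] [∀ x, InnerProductSpace ℝ (U x)]
  [FiberBundle F U] [VectorBundle ℝ F U]
  {S : SubRiemannianStructure n F U} {m : ℕ} {X : Fin m → VField n M}

namespace SubRiemannianStructure

/-- Linearly independent brackets with the right total length have the right multiplicities. -/
theorem IsGeneratingFamily.card_lt_eq_growth (hX : S.IsGeneratingFamily X)
    (hS : S.BracketGenerating) {ℓ : Fin n → ℕ} {v : Fin n → TangentSpace (𝓡 n) p}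
    (hv : LinearIndependent ℝ v) (hℓ : ∀ k, v k ∈ S.flagAt (ℓ k + 1) p)
    (h : ((∑ k, (ℓ k + 1) : ℕ) : ℤ) = S.homDim p) :
    (∀ k, ℓ k < S.step p) ∧
      ∀ i < S.step p, (Finset.univ.filter fun k => ℓ k < i).card = S.growth i p := by
  refine card_eq_of_sum_succ_eq (g := fun i => S.growth i p) ?_ (fun i _ => ?_) h
  · rw [growth, hX.flagAt_step hS, finrank_top]
    exact finrank_euclideanSpace_fin
  · refine card_le_finrank_of_linearIndependent hv _ _ fun k hk => ?_
    exact S.flagAt_mono p (Nat.succ_le_of_lt (Finset.mem_filter.1 hk).2) (hℓ k)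

theorem IsGeneratingFamily.isAdaptedFrame_of_word {r : ℕ} {I : Fin n → Word m r}
    (hI : ((∑ k, ((I k).1 + 1 : ℕ) : ℕ) : ℤ) = S.homDim p)
    (h : Ω p (fun k => wordField X (I k) p) ≠ 0) :
    S.IsAdaptedFrame X p fun k => List.ofFn (I k).2 where
  nonempty k := by simp [List.ofFn_succ]
  linearIndependent := linearIndependent_of_apply_ne_zero h
  span_eq_top := span_eq_top_of_linearIndependent (linearIndependent_of_apply_ne_zero h)
  length_eq := by simpa using hI

/-- By minimality of `Q`, no bracket of an adapted frame is longer than the step. So adapted frames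
are among the finitely many tuples of words indexing `frameSum`. -/
theorem IsAdaptedFrame.exists_word (hX : S.IsGeneratingFamily X) (hS : S.BracketGenerating)
    {I : Fin n → List (Fin m)} (hI : S.IsAdaptedFrame X p I) :
    ∃ J : Fin n → Word m (S.step p), ((∑ k, ((J k).1 + 1 : ℕ) : ℕ) : ℤ) = S.homDim p ∧
      ∀ k, wordField X (J k) = iteratedBracket ((I k).map X) := by
  have h1 : ∀ k, (I k).length - 1 + 1 = (I k).length := fun k =>
    Nat.sub_add_cancel (List.length_pos_of_ne_nil (hI.nonempty k))
  have h2 := hX.card_lt_eq_growth hS (ℓ := fun k => (I k).length - 1) hI.linearIndependent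
    (fun k => apply_mem_flagAt (hX.iteratedBracket_mem_flag (h1 k).ge) p) (by
      simp only [h1]; exact hI.length_eq)
  refine ⟨fun k => ⟨⟨(I k).length - 1, h2.1 k⟩, fun j => (I k).get (j.cast (h1 k))⟩, ?_,
    fun k => ?_⟩
  · simp only [h1]; exact hI.length_eq
  · have : List.ofFn (fun j : Fin ((I k).length - 1 + 1) => (I k).get (j.cast (h1 k))) = I k := by
      rw [← List.ofFn_congr (h1 k).symm (I k).get, List.ofFn_get]
    simp only [wordField, this]

variable [FiniteDimensional ℝ F]

/-- Popp's form in terms of the brackets. -/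
theorem IsPoppFormAt.sq_mul_frameSum (hX : S.IsGeneratingFamily X) (hS : S.BracketGenerating)
    (hp : p ∈ S.regularSet) {h : ℝ} (hϖ : S.IsPoppFormAt p (h • Ω p)) :
    h ^ 2 * frameSum X Ω (S.step p) (S.homDim p) p = n.factorial := by
  classical
  obtain ⟨b, hb, L, hL, hLb⟩ := hϖ
  -- Cauchy–Binet evaluates the sum of squared determinants of the classes; it remains to match it,
  -- term by term, with `h²` times the summands of `frameSum`.
  have hsum := sum_det_sq_of_isLeast (x := hX.wordVec p) (b := b) fun c => by
    rw [← hb c]; exact hX.isLeast_grSqNorm hp _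
  rw [← hsum, frameSum, Finset.mul_sum]
  refine Finset.sum_congr rfl fun I _ => ?_
  set v : Fin n → TangentSpace (𝓡 n) p := fun k => L (hX.wordVec p (I k)) with hv_def
  set v' : Fin n → TangentSpace (𝓡 n) p := fun k => wordField X (I k) p with hv'_def
  set ℓ : Fin n → ℕ := fun k => (I k).1 with hℓ_def
  have hL' : ∀ (i : Fin (S.step p)) (w : S.grPiece p i),
    (S.flagAt i p).mkQ (L.toLinearMap (Pi.single i w)) = w := hL
  have hdet : b.det (fun k => hX.wordVec p (I k)) = h * Ω p v := by
    rw [← hLb]; rfl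
  have hv : ∀ k, v k ∈ S.flagAt (ℓ k + 1) p := fun k => splitting_single_mem hL' _ _
  have hv' : ∀ k, v' k ∈ S.flagAt (ℓ k + 1) p := fun k =>
    apply_mem_flagAt (hX.wordField_mem_flag (I k)) p
  have hvv : ∀ k, v k - v' k ∈ S.flagAt (ℓ k) p := fun k => by
    rw [← Submodule.ker_mkQ (S.flagAt (ℓ k) p), LinearMap.mem_ker, map_sub, sub_eq_zero]
    exact hL (I k).1 _
  have hℓ : ∀ k, ℓ k < S.step p := fun k => (I k).1.2
  have hg : S.growth (S.step p) p = n := by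
    rw [growth, hX.flagAt_step hS, finrank_top]
    exact finrank_euclideanSpace_fin
  have heq : (∀ i < S.step p, (Finset.univ.filter fun k => ℓ k < i).card = S.growth i p) →
      Ω p v = Ω p v' := fun hN =>
    alternating_eq_of_filtration (S.flagAt_mono p) (Ω p) ℓ hv hvv fun k => (hN _ (hℓ k)).ge
  rw [hdet, mul_pow]
  have hsum' : (∑ k, ((I k).1 + 1 : ℕ) : ℕ) = ∑ k, (ℓ k + 1) := rfl
  rw [hsum']
  by_cases h0 : Ω p v = 0
  · rw [h0]
    split_ifs with hQ
    · have : Ω p v' = 0 := by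
        by_contra h1
        have h2 := hX.card_lt_eq_growth hS (linearIndependent_of_apply_ne_zero h1) hv' hQ
        exact h1 ((heq h2.2).symm.trans h0)
      rw [this]
    · simp
  · have hli := linearIndependent_of_apply_ne_zero h0
    have hspan : Submodule.span ℝ (Set.range fun k => hX.wordVec p (I k)) = ⊤ := by
      have h1 := span_eq_top_of_linearIndependent hli
      have h2 : Set.range v = L.toLinearMap '' (Set.range fun k => hX.wordVec p (I k)) := by
        rw [← Set.range_comp]; rfl
      rw [h2, ← Submodule.map_span] at h1
      exact Submodule.map_injective_of_injective L.injective (h1.trans (by simp))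
    -- Independence bounds the count from above. For the lower bound, a vector of `𝒟ⁱ_p` lifts to an
    -- element supported in degrees below `i`; as each `wordVec` is homogeneous, only those of
    -- degree below `i` contribute to it.
    have hN : ∀ i < S.step p, (Finset.univ.filter fun k => ℓ k < i).card = S.growth i p := by
      intro i hi
      apply le_antisymm
      · refine card_le_finrank_of_linearIndependent hli _ _ fun k hk => ?_
        exact S.flagAt_mono p (Nat.succ_le_of_lt (Finset.mem_filter.1 hk).2) (hv k)
      · have hle : S.flagAt i p ≤ Submodule.span ℝ
            (((Finset.univ.filter fun k => ℓ k < i).image v : Finset _) :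
              Set (TangentSpace (𝓡 n) p)) := by
          intro x hx
          obtain ⟨w, rfl, hw0⟩ := exists_splitting_eq hL' hi.le x hx
          obtain ⟨c, hc⟩ := (Submodule.mem_span_range_iff_exists_fun ℝ).1
            (hspan ▸ Submodule.mem_top : w ∈ _)
          have hw : w = ∑ k ∈ Finset.univ.filter (fun k => ℓ k < i),
              c k • hX.wordVec p (I k) := by
            funext j
            rw [Finset.sum_apply]
            by_cases hj : i ≤ j
            · rw [hw0 j hj, Finset.sum_eq_zero]
              intro k hk
              have hne : j ≠ (I k).1 := fun h => by
                have : ℓ k < i := (Finset.mem_filter.1 hk).2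
                have h' : (j : ℕ) = ℓ k := congrArg Fin.val h
                omega
              rw [Pi.smul_apply, IsGeneratingFamily.wordVec, Pi.single_eq_of_ne hne, smul_zero]
            · conv_lhs => rw [← hc]
              rw [Finset.sum_apply]
              symm
              refine Finset.sum_subset (Finset.filter_subset _ _) fun k _ hk => ?_
              have hne : j ≠ (I k).1 := fun h => by
                have h' : (j : ℕ) = ℓ k := congrArg Fin.val h
                exact hk (Finset.mem_filter.2 ⟨Finset.mem_univ _, by omega⟩)
              rw [Pi.smul_apply, IsGeneratingFamily.wordVec, Pi.single_eq_of_ne hne, smul_zero]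
          rw [hw, map_sum]
          refine Submodule.sum_mem _ fun k hk => ?_
          rw [map_smul]
          exact Submodule.smul_mem _ _ (Submodule.subset_span
            (Finset.mem_coe.2 (Finset.mem_image_of_mem v hk)))
        exact (Submodule.finrank_mono hle).trans
          ((finrank_span_finset_le_card _).trans Finset.card_image_le)
    have hQ : ((∑ k, (ℓ k + 1) : ℕ) : ℤ) = S.homDim p := sum_succ_eq_of_card_eq hg hℓ hN
    rw [if_pos hQ, heq hN]

end SubRiemannianStructure

end Frames

/-! ### Densities and suprema of measures. -/

section Density

variable {α β ι : Type*} [MeasurableSpace α] [MeasurableSpace β]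

theorem withDensity_mono_measure' {μ ν : Measure α} (h : μ ≤ ν) (f : α → ℝ≥0∞) :
    μ.withDensity f ≤ ν.withDensity f := by
  refine Measure.le_iff.2 fun s hs => ?_
  rw [withDensity_apply _ hs, withDensity_apply _ hs]
  exact lintegral_mono' (Measure.restrict_mono le_rfl h) le_rfl

theorem withDensity_mul_inv {μ : Measure α} {f : α → ℝ≥0∞} (hf : Measurable f)
    (hf' : ∀ x, f x ≠ ⊤) : μ.withDensity (f * f⁻¹) = μ.restrict {x | f x = 0}ᶜ := by
  have hA : MeasurableSet {x | f x = 0} := hf (measurableSet_singleton 0)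
  rw [← withDensity_indicator_one hA.compl]
  congr 1
  ext x
  by_cases hx : f x = 0
  · simp [hx]
  · simp [hx, ENNReal.mul_inv_cancel hx (hf' x)]

/-- Densities commute with suprema of measures. -/
theorem iSup_withDensity (μ : ι → Measure α) {f : α → ℝ≥0∞} (hf : Measurable f)
    (hf' : ∀ x, f x ≠ ⊤) :
    ⨆ i, (μ i).withDensity f = (⨆ i, μ i).withDensity f := by
  have hA : MeasurableSet {x | f x = 0} := hf (measurableSet_singleton 0)
  apply le_antisymm
  · exact iSup_le fun i => withDensity_mono_measure' (le_iSup μ i) f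
  · set ν := ⨆ i, (μ i).withDensity f
    set μ' := ⨆ i, μ i
    -- Off the zeros of `f` one divides by `f`; on the zeros a crude bound suffices, since
    -- multiplying by `f` again kills that summand.
    have h1 : μ' ≤ ν.withDensity f⁻¹ + μ'.restrict {x | f x = 0} := by
      refine iSup_le fun i => ?_
      rw [← Measure.restrict_compl_add_restrict (μ := μ i) hA]
      refine add_le_add ?_ (Measure.restrict_mono le_rfl (le_iSup μ i))
      rw [← withDensity_mul_inv hf hf', withDensity_mul _ hf hf.inv]
      exact withDensity_mono_measure' (le_iSup (fun i => (μ i).withDensity f) i) _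
    have h2 := withDensity_mono_measure' h1 f
    rw [withDensity_add_measure, ← withDensity_mul _ hf.inv hf, mul_comm,
      withDensity_mul_inv hf hf', ← withDensity_indicator hA,
      show Set.indicator {x | f x = 0} f = 0 from
        funext fun x => by by_cases hx : f x = 0 <;> simp [hx], withDensity_zero, add_zero] at h2
    exact h2.trans Measure.restrict_le_self

theorem map_withDensity_comp_mul {μ : Measure α} [SFinite μ] {φ : α → β} (hφ : AEMeasurable φ μ)
    {c : α → ℝ≥0∞} (hc : AEMeasurable c μ) {g : β → ℝ≥0∞} (hg : Measurable g) :
    Measure.map φ (μ.withDensity fun y => g (φ y) * c y)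
      = (Measure.map φ (μ.withDensity c)).withDensity g := by
  have hac : ∀ c : α → ℝ≥0∞, AEMeasurable φ (μ.withDensity c) := fun c =>
    hφ.mono_ac (withDensity_absolutelyContinuous _ _)
  ext s hs
  have hgs : Measurable (s.indicator g) := hg.indicator hs
  rw [Measure.map_apply_of_aemeasurable (hac _) hs, withDensity_apply _ hs,
    ← lintegral_indicator hs, lintegral_map' hgs.aemeasurable (hac _), withDensity_apply']
  have h1 := lintegral_withDensity_eq_lintegral_mul₀ hc (hgs.comp_aemeasurable hφ)
  simp only [Function.comp_def] at h1
  rw [h1]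
  have hns : NullMeasurableSet (φ ⁻¹' s) μ := hφ.nullMeasurableSet_preimage hs
  rw [← lintegral_indicator₀ hns]
  refine lintegral_congr fun y => ?_
  by_cases hy : φ y ∈ s
  · simp [Set.indicator, hy, mul_comm]
  · simp [Set.indicator, hy]

end Density

/-! ### Measures of forms, and continuity of forms on smooth fields. -/

section FormMeasure

variable {n : ℕ} {M : Type*} [TopologicalSpace M] [ChartedSpace (EuclideanSpace ℝ (Fin n)) M]
  {Ω : TopForm n M}

theorem coordCoeff_smul {Ω' : TopForm n M} {h : M → ℝ} (hΩ' : ∀ p, Ω' p = h p • Ω p)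
    (e : OpenPartialHomeomorph M (EuclideanSpace ℝ (Fin n))) (y : EuclideanSpace ℝ (Fin n)) :
    coordCoeff e Ω' y = h (e.symm y) * coordCoeff e Ω y := by
  rw [coordCoeff, hΩ' (e.symm y), AlternatingMap.smul_apply, smul_eq_mul, coordCoeff]

theorem chartMeasure_eq_withDensity [MeasurableSpace M] [BorelSpace M]
    (hΩ : IsVolumeForm Ω) {Ω' : TopForm n M} {h : M → ℝ} (hΩ' : ∀ p, Ω' p = h p • Ω p)
    (hh : Measurable fun p => |h p|) {e : OpenPartialHomeomorph M (EuclideanSpace ℝ (Fin n))}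
    (he : e ∈ atlas (EuclideanSpace ℝ (Fin n)) M) :
    chartMeasure e Ω' = (chartMeasure e Ω).withDensity fun p => ENNReal.ofReal |h p| := by
  have h1 : (fun y => ENNReal.ofReal |coordCoeff e Ω' y|)
      = fun y => ENNReal.ofReal |h (e.symm y)| * ENNReal.ofReal |coordCoeff e Ω y| := by
    funext y
    rw [← ENNReal.ofReal_mul (abs_nonneg _), ← abs_mul, coordCoeff_smul hΩ']
  have h2 : AEMeasurable (fun y => |coordCoeff e Ω y|) (volume.restrict e.target) :=
    (hΩ.smooth e he).continuousOn.abs.aemeasurable e.open_target.measurableSet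
  have h3 : AEMeasurable e.symm (volume.restrict e.target) :=
    e.continuousOn_symm.aemeasurable e.open_target.measurableSet
  unfold chartMeasure
  rw [h1]
  exact map_withDensity_comp_mul (g := fun p => ENNReal.ofReal |h p|) h3 h2.ennreal_ofReal
    hh.ennreal_ofReal

theorem formMeasure_eq_withDensity [MeasurableSpace M] [BorelSpace M]
    (hΩ : IsVolumeForm Ω) {Ω' : TopForm n M} {h : M → ℝ} (hΩ' : ∀ p, Ω' p = h p • Ω p)
    (hh : Measurable fun p => |h p|) :
    formMeasure Ω' = (formMeasure Ω).withDensity fun p => ENNReal.ofReal |h p| := by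
  rw [formMeasure, formMeasure, ← iSup_withDensity _ hh.ennreal_ofReal fun _ => ENNReal.ofReal_ne_top]
  exact iSup_congr fun x => chartMeasure_eq_withDensity hΩ hΩ' hh (chart_mem_atlas _ x)

/-- The values of a smooth form of top degree on smooth vector fields are continuous. -/
theorem IsVolumeForm.continuous_apply [IsManifold (𝓡 n) ∞ M] (hΩ : IsVolumeForm Ω)
    {Y : Fin n → VField n M} (hY : ∀ k, (Y k).Smooth) :
    Continuous fun q => Ω q fun k => Y k q := by
  rw [continuous_iff_continuousAt]
  intro p
  let b := (EuclideanSpace.basisFun (Fin n) ℝ).toBasis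
  -- The chart is centred at the point where continuity is tested, because
  -- `differentiableAt_chartRead` speaks of the centre only.
  let e := chartAt (EuclideanSpace ℝ (Fin n)) p
  have key : ∀ y ∈ (extChartAt (𝓡 n) p).target,
      (Ω ((extChartAt (𝓡 n) p).symm y) fun k => Y k ((extChartAt (𝓡 n) p).symm y))
        = coordCoeff e Ω y * b.det fun k => chartRead p (Y k) y := by
    intro y hy
    obtain ⟨L, hL, hLY⟩ := exists_linearEquiv_chartRead hy
    have h1 := AlternatingMap.congr_fun (AlternatingMap.eq_smul_basis_det b
      ((Ω ((extChartAt (𝓡 n) p).symm y)).compLinearMap L.toLinearMap))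
      (fun k => chartRead p (Y k) y)
    rw [AlternatingMap.smul_apply, smul_eq_mul] at h1
    have h2 : (fun k => L (chartRead p (Y k) y)) = fun k => Y k ((extChartAt (𝓡 n) p).symm y) :=
      funext fun k => hLY (Y k)
    rw [← h2]
    refine h1.trans (congrArg (· * _) ?_)
    have h3 : (fun k => L (b k)) = fun k => mfderiv (𝓡 n) (𝓡 n) (extChartAt (𝓡 n) p).symm y
        (EuclideanSpace.single k (1 : ℝ)) := funext fun k => by
      rw [hL]; simp [b]
    exact congrArg (Ω ((extChartAt (𝓡 n) p).symm y)) h3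
  have hev : (fun q => Ω q fun k => Y k q) =ᶠ[𝓝 p] fun q =>
      coordCoeff e Ω (extChartAt (𝓡 n) p q)
        * b.det fun k => chartRead p (Y k) (extChartAt (𝓡 n) p q) := by
    filter_upwards [extChartAt_source_mem_nhds (I := 𝓡 n) p] with q hq
    rw [← key _ ((extChartAt (𝓡 n) p).map_source hq), (extChartAt (𝓡 n) p).left_inv hq]
  refine ContinuousAt.congr ?_ hev.symm
  have hφ := continuousAt_extChartAt (I := 𝓡 n) p
  refine ContinuousAt.mul ?_ ?_
  · have h1 : extChartAt (𝓡 n) p p ∈ e.target := e.map_source (mem_chart_source _ p)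
    exact ContinuousAt.comp (f := extChartAt (𝓡 n) p)
      (((hΩ.smooth e (chart_mem_atlas _ p)).continuousOn).continuousAt (e.open_target.mem_nhds h1))
      hφ
  · simp only [Module.Basis.det_apply]
    have h2 : ContinuousAt (fun q => (b.toMatrix fun k => chartRead p (Y k) (extChartAt (𝓡 n) p q))) p := by
      refine continuousAt_pi.2 fun i => continuousAt_pi.2 fun j => ?_
      have h3 : ContinuousAt (fun q => chartRead p (Y j) (extChartAt (𝓡 n) p q)) p :=
        ContinuousAt.comp (f := extChartAt (𝓡 n) p)
          (differentiableAt_chartRead (hY j) p).continuousAt hφ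
      have h4 : Continuous fun v : EuclideanSpace ℝ (Fin n) => v i := by fun_prop
      have h5 := h4.continuousAt.comp h3
      simpa [Module.Basis.toMatrix_apply, b, Function.comp_def] using h5
    exact ContinuousAt.comp (Continuous.matrix_det continuous_id).continuousAt h2

theorem continuous_frameSum [IsManifold (𝓡 n) ∞ M] (hΩ : IsVolumeForm Ω) {m : ℕ}
    {X : Fin m → VField n M} (hX : ∀ a, (X a).Smooth) (r : ℕ) (d : ℤ) :
    Continuous (frameSum X Ω r d) := by
  refine continuous_finsetSum _ fun I _ => ?_
  split_ifs
  · refine (hΩ.continuous_apply fun k => iteratedBracket_smooth _ fun V hV => ?_).pow 2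
    obtain ⟨a, -, rfl⟩ := List.mem_map.1 hV
    exact hX a
  · exact continuous_const

end FormMeasure

/-! ### Comparison of `ν`, the frame sum and Popp's form. -/

section Bounds

variable {n : ℕ} {M : Type*} [TopologicalSpace M] [ChartedSpace (EuclideanSpace ℝ (Fin n)) M]
  [IsManifold (𝓡 n) ∞ M]
  {F : Type*} [NormedAddCommGroup F] [NormedSpace ℝ F]
  {U : M → Type*} [TopologicalSpace (TotalSpace F U)]
  [∀ x, NormedAddCommGroup (U x)] [∀ x, InnerProductSpace ℝ (U x)]
  [FiberBundle F U] [VectorBundle ℝ F U]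
  {S : SubRiemannianStructure n F U} {m : ℕ} {X : Fin m → VField n M} {Ω : TopForm n M} {p : M}

namespace SubRiemannianStructure

variable (S) in
theorem isOpen_regularSet : IsOpen S.regularSet := by
  rw [isOpen_iff_mem_nhds]
  intro p hp
  have h : ∀ᶠ q in 𝓝 p, ∀ i, S.growth i q = S.growth i p := hp
  filter_upwards [h.eventually_nhds] with q hq
  have hq' := hq.self_of_nhds
  exact hq.mono fun x hx i => (hx i).trans (hq' i).symm

theorem flagAt_eq_top_iff (i : ℕ) (p : M) : S.flagAt i p = ⊤ ↔ S.growth i p = n := by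
  have hn : Module.finrank ℝ (TangentSpace (𝓡 n) p) = n := finrank_euclideanSpace_fin
  constructor
  · intro h
    rw [growth, h, finrank_top, hn]
  · intro h
    exact Submodule.eq_top_of_finrank_eq (h.trans hn.symm)

theorem step_eq_of_growth_eq {p q : M} (h : ∀ i, S.growth i q = S.growth i p) :
    S.step q = S.step p := by
  simp only [step, flagAt_eq_top_iff, h]

theorem homDim_eq_of_growth_eq {p q : M} (h : ∀ i, S.growth i q = S.growth i p) :
    S.homDim q = S.homDim p := by
  simp only [homDim, step_eq_of_growth_eq h, h]

/-- Exchanging the first two brackets, possible as `n ≥ 2`, keeps the frame adapted. So the maximum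
`ν` of `Ω` also bounds `|Ω|` on adapted frames. -/
theorem neg_mem_frameValues (hn : 2 ≤ n) {t : ℝ} (ht : t ∈ S.frameValues X Ω p) :
    -t ∈ S.frameValues X Ω p := by
  obtain ⟨I, hI, rfl⟩ := ht
  let i : Fin n := ⟨0, by omega⟩
  let j : Fin n := ⟨1, by omega⟩
  have hij : i ≠ j := fun h => by simpa [i, j] using congrArg Fin.val h
  let σ := Equiv.swap i j
  refine ⟨I ∘ σ, ⟨fun k => hI.nonempty _, hI.linearIndependent.comp σ σ.injective, ?_, ?_⟩, ?_⟩
  · rw [← hI.span_eq_top]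
    congr 1
    exact σ.surjective.range_comp fun k => iteratedBracket ((I k).map X) p
  · rw [← hI.length_eq]
    exact congrArg _ (Equiv.sum_comp σ fun k => (I k).length)
  · exact ((Ω p).map_swap (fun k => iteratedBracket ((I k).map X) p) hij).symm

theorem finite_frameValues (hX : S.IsGeneratingFamily X) (hS : S.BracketGenerating) :
    (S.frameValues X Ω p).Finite := by
  refine (Set.finite_range fun J : Fin n → Word m (S.step p) =>
    Ω p fun k => wordField X (J k) p).subset ?_
  rintro _ ⟨I, hI, rfl⟩
  obtain ⟨J, -, hJ⟩ := hI.exists_word hX hS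
  exact ⟨J, by simp only [hJ]⟩

theorem isGreatest_nu (hX : S.IsGeneratingFamily X) (hS : S.BracketGenerating)
    (hne : (S.frameValues X Ω p).Nonempty) : IsGreatest (S.frameValues X Ω p) (S.nu X Ω p) :=
  have hfin := finite_frameValues (Ω := Ω) (p := p) hX hS
  ⟨hne.csSup_mem hfin, fun _ ht => le_csSup hfin.bddAbove ht⟩

theorem abs_le_nu (hn : 2 ≤ n) (hν : IsGreatest (S.frameValues X Ω p) (S.nu X Ω p)) {t : ℝ}
    (ht : t ∈ S.frameValues X Ω p) : |t| ≤ S.nu X Ω p :=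
  abs_le.2 ⟨by linarith [hν.2 (neg_mem_frameValues hn ht)], hν.2 ht⟩

theorem frameValues_nonempty (h : frameSum X Ω (S.step p) (S.homDim p) p ≠ 0) :
    (S.frameValues X Ω p).Nonempty := by
  obtain ⟨I, -, hI⟩ := Finset.exists_ne_zero_of_sum_ne_zero h
  split_ifs at hI with hQ
  · exact ⟨_, _, IsGeneratingFamily.isAdaptedFrame_of_word hQ (pow_ne_zero_iff two_ne_zero |>.1 hI),
      rfl⟩
  · exact absurd rfl hI

theorem nu_pos (hn : 2 ≤ n) (hΩ : Ω p ≠ 0)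
    (hν : IsGreatest (S.frameValues X Ω p) (S.nu X Ω p)) : 0 < S.nu X Ω p := by
  obtain ⟨I, hI, ht⟩ := hν.1
  have h1 : S.nu X Ω p ≠ 0 := ht ▸ apply_ne_zero_of_linearIndependent hΩ hI.linearIndependent
  exact (abs_pos.2 h1).trans_le (abs_le_nu hn hν hν.1)

theorem nu_sq_le_frameSum (hX : S.IsGeneratingFamily X) (hS : S.BracketGenerating)
    (hν : IsGreatest (S.frameValues X Ω p) (S.nu X Ω p)) :
    S.nu X Ω p ^ 2 ≤ frameSum X Ω (S.step p) (S.homDim p) p := by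
  obtain ⟨I, hI, ht⟩ := hν.1
  obtain ⟨J, hJ, hJI⟩ := hI.exists_word hX hS
  have h1 := Finset.single_le_sum (s := Finset.univ)
    (f := fun I : Fin n → Word m (S.step p) =>
      if ((∑ k, ((I k).1 + 1 : ℕ) : ℕ) : ℤ) = S.homDim p then
        Ω p (fun k => wordField X (I k) p) ^ 2 else 0)
    (fun I _ => by split_ifs <;> positivity) (Finset.mem_univ J)
  refine le_trans (le_of_eq ?_) h1
  simp only [if_pos hJ, hJI, ht]

theorem frameSum_le (hn : 2 ≤ n) (hν : IsGreatest (S.frameValues X Ω p) (S.nu X Ω p)) :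
    frameSum X Ω (S.step p) (S.homDim p) p
      ≤ Fintype.card (Fin n → Word m (S.step p)) * S.nu X Ω p ^ 2 := by
  rw [← nsmul_eq_mul, Fintype.card, ← Finset.sum_const]
  refine Finset.sum_le_sum fun I _ => ?_
  split_ifs with hQ
  · by_cases h0 : Ω p (fun k => wordField X (I k) p) = 0
    · rw [h0, zero_pow two_ne_zero]; positivity
    · exact sq_le_sq' (abs_le.1 (abs_le_nu hn hν
        ⟨_, IsGeneratingFamily.isAdaptedFrame_of_word hQ h0, rfl⟩)).1
        (hν.2 ⟨_, IsGeneratingFamily.isAdaptedFrame_of_word hQ h0, rfl⟩)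
  · positivity

theorem isPoppFormAt_poppForm [FiniteDimensional ℝ F] (hX : S.IsGeneratingFamily X)
    (hS : S.BracketGenerating) (hp : p ∈ S.regularSet) : S.IsPoppFormAt p (S.poppForm p) := by
  have h : p ∈ S.regularSet ∧ ∃ ϖ, S.IsPoppFormAt p ϖ := ⟨hp, hX.exists_isPoppFormAt hS hp⟩
  rw [poppForm, dif_pos h]
  exact h.2.choose_spec

/-- The absolute value of Popp's form is a continuous multiple of a volume form on the regular
set. -/
theorem exists_poppForm_eq_smul [FiniteDimensional ℝ F] (hX : S.IsGeneratingFamily X)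
    (hS : S.BracketGenerating) (hΩ : IsVolumeForm Ω) :
    ∃ h : M → ℝ, (∀ p, S.poppForm p = h p • Ω p) ∧ (∀ p ∉ S.regularSet, h p = 0) ∧
      (∀ p ∈ S.regularSet, h p ^ 2 * frameSum X Ω (S.step p) (S.homDim p) p = n.factorial) ∧
      ContinuousOn (fun p => |h p|) S.regularSet := by
  choose h hh using fun p => exists_eq_smul (hΩ.ne_zero p) (S.poppForm p)
  have hsq : ∀ p ∈ S.regularSet,
      h p ^ 2 * frameSum X Ω (S.step p) (S.homDim p) p = n.factorial := fun p hp =>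
    IsPoppFormAt.sq_mul_frameSum hX hS hp (hh p ▸ isPoppFormAt_poppForm hX hS hp)
  refine ⟨h, hh, fun p hp => ?_, hsq, fun p hp => ContinuousAt.continuousWithinAt ?_⟩
  · have h1 := hh p
    rw [poppForm, dif_neg fun h => hp h.1] at h1
    exact (smul_eq_zero.1 h1.symm).resolve_right (hΩ.ne_zero p)
  · have hne : frameSum X Ω (S.step p) (S.homDim p) p ≠ 0 := fun h0 => by
      have := hsq p hp
      rw [h0, mul_zero] at this
      exact (Nat.cast_ne_zero.2 n.factorial_ne_zero) this.symm
    have hcont := continuous_frameSum hΩ hX.smooth (S.step p) (S.homDim p)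
    -- The length bound and the total length are frozen at their values at `p`, which are also their
    -- values at nearby points; only `|h|` is determined, as the sign of `poppForm` is an arbitrary
    -- choice.
    have h1 : ContinuousAt (fun q => √(n.factorial / frameSum X Ω (S.step p) (S.homDim p) q)) p :=
      (continuousAt_const.div hcont.continuousAt hne).sqrt
    refine h1.congr ?_
    have hp' : ∀ᶠ q in 𝓝 p, ∀ i, S.growth i q = S.growth i p := hp
    filter_upwards [hp', S.isOpen_regularSet.mem_nhds hp, hcont.continuousAt.eventually_ne hne]
      with q hq hqR hq0
    have h2 := hsq q hqR
    rw [step_eq_of_growth_eq hq, homDim_eq_of_growth_eq hq] at h2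
    rw [← h2, mul_div_assoc, div_self hq0, mul_one, Real.sqrt_sq_eq_abs]

end SubRiemannianStructure

end Bounds

end Popp

/-! ### The density of Popp's measure and its two-sided bound. -/

theorem mainTheorem4 {n m : ℕ} (hn : 2 ≤ n)
    {M : Type*} [TopologicalSpace M] [T2Space M] [SecondCountableTopology M]
    [ChartedSpace (EuclideanSpace ℝ (Fin n)) M] [IsManifold (𝓡 n) ∞ M]
    [MeasurableSpace M] [BorelSpace M]
    {F : Type*} [NormedAddCommGroup F] [NormedSpace ℝ F] [FiniteDimensional ℝ F]
    {U : M → Type*} [TopologicalSpace (TotalSpace F U)]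
    [∀ x, NormedAddCommGroup (U x)] [∀ x, InnerProductSpace ℝ (U x)]
    [FiberBundle F U] [VectorBundle ℝ F U] [ContMDiffVectorBundle ∞ F U (𝓡 n)]
    [IsContMDiffRiemannianBundle (𝓡 n) ∞ F U]
    (S : Popp.SubRiemannianStructure n F U) (hS : S.BracketGenerating)
    (X : Fin m → Popp.VField n M) (hX : S.IsGeneratingFamily X)
    (Ω : Popp.TopForm n M) (hΩ : Popp.IsVolumeForm Ω) :
    ∃ ρ : M → ℝ, ContinuousOn ρ S.regularSet ∧
      S.poppMeasure =
        ((Popp.formMeasure Ω).restrict S.regularSet).withDensity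
          (fun q => ENNReal.ofReal (ρ q)) ∧
      ∀ K : Set M, IsCompact K → ∃ C : ℝ, 0 < C ∧ ∀ q ∈ S.regularSet ∩ K,
        IsGreatest (S.frameValues X Ω q) (S.nu X Ω q) ∧ 0 < S.nu X Ω q ∧
        1 / (C * S.nu X Ω q) ≤ ρ q ∧ ρ q ≤ C / S.nu X Ω q := by
  classical
  obtain ⟨h, hh, h0, hsq, hcont⟩ := S.exists_poppForm_eq_smul hX hS hΩ
  refine ⟨fun p => |h p|, hcont, ?_, fun K _ => ?_⟩
  · have hR := S.isOpen_regularSet.measurableSet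
    have hmeas : Measurable fun p => |h p| := by
      have h1 : (fun p => |h p|) = S.regularSet.piecewise (fun p => |h p|) fun _ => 0 := by
        funext p
        by_cases hp : p ∈ S.regularSet
        · simp [hp]
        · simp [hp, h0 p hp]
      rw [h1]
      exact hcont.measurable_piecewise continuousOn_const hR
    rw [Popp.SubRiemannianStructure.poppMeasure, Popp.formMeasure_eq_withDensity hΩ hh hmeas,
      ← withDensity_indicator hR]
    congr 1
    funext p
    by_cases hp : p ∈ S.regularSet
    · simp [hp]
    · simp [hp, h0 p hp]
  -- The step at a regular point is some `r ≤ n`; summing over all of them bounds the number of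
  -- tuples by a constant depending on `n` and `m` only.
  · let N : ℕ := ∑ r ∈ Finset.range (n + 1), Fintype.card (Fin n → Popp.Word m r)
    have hf1 : (1 : ℝ) ≤ n.factorial := mod_cast Nat.one_le_iff_ne_zero.2 n.factorial_ne_zero
    -- From `ρ² G = n!` and `ν² ≤ G ≤ N ν²` one gets `n!/N ≤ (ρ ν)² ≤ n!`. Both bounds on `ρ ν`
    -- follow once `C` is at least `1`, `n!` and `N`.
    refine ⟨n.factorial + N, by positivity, fun q hq => ?_⟩
    have hG := hsq q hq.1
    set G := Popp.frameSum X Ω (S.step q) (S.homDim q) q with hG_def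
    have hG0 : G ≠ 0 := fun h1 => by
      rw [h1, mul_zero] at hG
      linarith
    have hν := S.isGreatest_nu hX hS (S.frameValues_nonempty hG0)
    have hpos := S.nu_pos hn (hΩ.ne_zero q) hν
    have hle := S.nu_sq_le_frameSum hX hS hν
    have hge := S.frameSum_le hn hν
    rw [← hG_def] at hle hge
    have hcard : (Fintype.card (Fin n → Popp.Word m (S.step q)) : ℝ) ≤ N := by
      have := Finset.single_le_sum (s := Finset.range (n + 1))
        (f := fun r => Fintype.card (Fin n → Popp.Word m r)) (fun _ _ => Nat.zero_le _)
        (Finset.mem_range.2 (Nat.lt_succ_of_le (hX.step_le hS hq.1)))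
      exact_mod_cast this
    set ν := S.nu X Ω q
    have hN0 : (0 : ℝ) ≤ N := Nat.cast_nonneg N
    have hge' : G ≤ N * ν ^ 2 := hge.trans (by gcongr)
    have hρ0 : 0 ≤ |h q| := abs_nonneg _
    rw [← sq_abs] at hG
    set ρ := |h q|
    set C : ℝ := n.factorial + N with hC
    have hC1 : 1 ≤ C := by linarith
    have h1 : (ρ * ν) ^ 2 ≤ n.factorial := by
      rw [mul_pow, ← hG]; gcongr
    have h2 : (n.factorial : ℝ) ≤ N * (ρ * ν) ^ 2 := by
      rw [← hG]
      calc ρ ^ 2 * G ≤ ρ ^ 2 * (N * ν ^ 2) := by gcongr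
        _ = _ := by ring
    refine ⟨hν, hpos, ?_, ?_⟩
    · rw [div_le_iff₀ (by positivity)]
      have h3 : 1 ≤ (ρ * (C * ν)) ^ 2 := by
        calc (1 : ℝ) ≤ N * (ρ * ν) ^ 2 := hf1.trans h2
          _ ≤ C ^ 2 * (ρ * ν) ^ 2 := by
            gcongr
            nlinarith
          _ = _ := by ring
      exact (one_le_sq_iff₀ (by positivity)).1 h3
    · rw [le_div_iff₀ hpos]
      refine le_of_sq_le_sq (h1.trans ?_) (by positivity)
      nlinarith
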